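/- **Combinatorial formula for the multiparameter and the factorial Schur Q-functions.** A strict partition is a finite sequence of positive integers $\lambda=(\lambda_1>\lambda_2>\dots>\lambda_l>0)$, $l=\ell(\lambda)\ge 0$. Its shifted Young diagram is $$D'_\lambda=\{(i,j)\in\mathbb Z^2 \mid 1\le i\le l,\ i\le j\le \lambda_i+i-1\}.$$ For a sequence $a=(a_k)_{k\ge 1}$ of complex numbers put $(x\mid a)^m=\prod_{k=1}^m(x-a_k)$, and put $(x\downarrow m)=\prod_{k=1}^m(x-k+1)$. For $n\ge l$ let $$Q_{\lambda;a}(x_1,\dots,x_n)=\frac{2^{l}}{(n-l)!}\sum_{\omega\in S(n)}\ \prod_{i=1}^l (x_{\omega(i)}\mid a)^{\lambda_i}\prod_{i\le l,\ i<j\le n}\frac{x_{\omega(i)}+x_{\omega(j)}}{x_{\omega(i)}-x_{\omega(j)}},$$ let $Q^*_\lambda(x_1,\dots,x_n)$ be given by the same formula with $(x_{\omega(i)}\downarrow\lambda_i)$ in place of $(x_{\omega(i)}\mid a)^{\lambda_i}$, and let both be $0$ for $n<l$. Consider the ordered alphabet $\mathbb P_n=\{1'<1<2'<2<\dots<n'<n\}$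 with $|k'|=|k|=k$, $\operatorname{sgn}(k)=1$, $\operatorname{sgn}(k')=-1$. Let $MSTab(\lambda,n)$ be the set of marked shifted Young tableaux of shape $\lambda$ and length $n$, that is, of the maps $T:D'_\lambda\to\mathbb P_n$ such that $T(i,j)\le T(i+1,j)$ and $T(i,j)\le T(i,j+1)$ whenever both boxes lie in $D'_\lambda$, and such that each unmarked letter $k$ occurs at most once in each column and each marked letter $k'$ occurs at most once in each row. Then for every strict partition $\lambda$ and every $n\ge 0$, as an identity of rational functions in $x_1,\dots,x_n$ (so that the left-hand sides are polynomials): 1. for every sequence $a$ of complex numbers with $a_1=0$, $$Q_{\lambda;a}(x_1,\dots,x_n)=\sum_{T\in MSTab(\lambda,n)}\ \prod_{(i,j)\in D'_\lambda}\bigl(x_{|T(i,j)|}-\operatorname{sgn}(T(i,j))\,a_{j-i+1}\bigr);$$ 2. (the case $a_k=k-1$) $$Q^*_{\lambda}(x_1,\dots,x_n)=\sum_{T\in MSTab(\lambda,n)}\ \prod_{(i,j)\in D'_\lambda}\bigl(x_{|T(i,j)|}-\operatorname{sgn}(T(i,j))\,(j-i)\bigr).$$ -/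

import Mathlib

namespace MultiparamSchur

/-- A strict partition `lam_1 > lam_2 > ... > lam_l > 0`, given by its nonzero parts.  The index
`i : Fin length` has value `i - 1` for the `i`-th part; the empty partition has length `0`. -/
structure StrictPartition where
  /-- the number `l` of nonzero parts -/
  length : ℕ
  /-- the nonzero parts, in decreasing order -/
  part : Fin length → ℕ
  strictAnti : StrictAnti part
  pos : ∀ i, 0 < part i

/-- The shifted Young diagram `{(i, j) | 1 ≤ i ≤ l, i ≤ j ≤ lam_i + i - 1}`.  Rows and columns are
numbered from one; the row with number `i + 1` carries the part with index `i`. -/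
def StrictPartition.shiftedDiagram (lam : StrictPartition) : Finset (ℕ × ℕ) :=
  Finset.univ.biUnion fun i : Fin lam.length =>
    {(i : ℕ) + 1} ×ˢ Finset.Icc ((i : ℕ) + 1) (lam.part i + i)

/-- The generalized power `(x | a)^m = (x - a_1) (x - a_2) ... (x - a_m)`.  A sequence
`(a_k)_{k ≥ 1}` is a function on `ℕ` whose value at `0` is never used. -/
noncomputable def genPow {R : Type*} [CommRing R] [Algebra ℂ R] (a : ℕ → ℂ) (m : ℕ) (x : R) : R :=
  ∏ k ∈ Finset.Icc 1 m, (x - algebraMap ℂ R (a k))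

/-- The falling power `(x ↓ m) = x (x - 1) ... (x - m + 1)`. -/
def fallingPow {R : Type*} [CommRing R] (m : ℕ) (x : R) : R :=
  ∏ k ∈ Finset.Icc 1 m, (x - (k : R) + 1)

/-- The field `ℂ(x_1, ..., x_n)` of rational functions. -/
abbrev RatFun (n : ℕ) : Type := FractionRing (MvPolynomial (Fin n) ℂ)

/-- The variable `x_i` as a rational function. -/
noncomputable def ratVar {n : ℕ} (i : Fin n) : RatFun n :=
  algebraMap (MvPolynomial (Fin n) ℂ) (RatFun n) (MvPolynomial.X i)

/-- The symmetrization, for `l ≤ n`,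
`1 / (n - l)! * ∑_ω ∏_{i ≤ l} g_i(x_{ω i}) *
  ∏_{i ≤ l, i < j ≤ n} (x_{ω i} + x_{ω j}) / (x_{ω i} - x_{ω j})`,
the sum being over all permutations `ω` of `{1, ..., n}`; it is `0` for `n < l`. -/
noncomputable def symmSum (l n : ℕ) (g : Fin l → RatFun n → RatFun n) : RatFun n :=
  if h : l ≤ n then
    (1 / ((n - l).factorial : RatFun n)) *
      ∑ ω : Equiv.Perm (Fin n),
        (∏ i : Fin l, g i (ratVar (ω (Fin.castLE h i)))) *
          ∏ i : Fin l, ∏ j ∈ Finset.Ioi (Fin.castLE h i),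
            (ratVar (ω (Fin.castLE h i)) + ratVar (ω j)) /
              (ratVar (ω (Fin.castLE h i)) - ratVar (ω j))
  else 0

/-- The multiparameter Schur P-function `P_{lam;a}(x_1, ..., x_n)`. -/
noncomputable def multiP (lam : StrictPartition) (a : ℕ → ℂ) (n : ℕ) : RatFun n :=
  symmSum lam.length n fun i => genPow a (lam.part i)

/-- The multiparameter Schur Q-function `Q_{lam;a}(x_1, ..., x_n)`. -/
noncomputable def multiQ (lam : StrictPartition) (a : ℕ → ℂ) (n : ℕ) : RatFun n :=
  2 ^ lam.length * multiP lam a n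

/-- The factorial Schur P-function `P*_lam(x_1, ..., x_n)`. -/
noncomputable def factorialP (lam : StrictPartition) (n : ℕ) : RatFun n :=
  symmSum lam.length n fun i => fallingPow (lam.part i)

/-- The factorial Schur Q-function `Q*_lam(x_1, ..., x_n)`. -/
noncomputable def factorialQ (lam : StrictPartition) (n : ℕ) : RatFun n :=
  2 ^ lam.length * factorialP lam n

/-- The ordered alphabet `1' < 1 < 2' < 2 < ... < n' < n`: lexicographically ordered pairs, where
`(k, false)` is the marked letter `k'` and `(k, true)` is the unmarked letter `k`. -/
abbrev Letter (n : ℕ) : Type := Fin n ×ₗ Bool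

namespace Letter

/-- The marked letter `k'`. -/
def marked {n : ℕ} (k : Fin n) : Letter n := toLex (k, false)

/-- The unmarked letter `k`. -/
def unmarked {n : ℕ} (k : Fin n) : Letter n := toLex (k, true)

/-- `|k'| = |k| = k`. -/
def abs {n : ℕ} (t : Letter n) : Fin n := (ofLex t).1

/-- `sgn k = 1` and `sgn k' = -1`. -/
def sgn {n : ℕ} (t : Letter n) : ℂ := if (ofLex t).2 then 1 else -1

end Letter

/-- `T` is a marked shifted Young tableau of shape `lam` and length `n`. -/
structure IsMarkedTableau (lam : StrictPartition) (n : ℕ)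
    (T : lam.shiftedDiagram → Letter n) : Prop where
  col_le : ∀ (i j : ℕ) (h : (i, j) ∈ lam.shiftedDiagram) (h' : (i + 1, j) ∈ lam.shiftedDiagram),
    T ⟨(i, j), h⟩ ≤ T ⟨(i + 1, j), h'⟩
  row_le : ∀ (i j : ℕ) (h : (i, j) ∈ lam.shiftedDiagram) (h' : (i, j + 1) ∈ lam.shiftedDiagram),
    T ⟨(i, j), h⟩ ≤ T ⟨(i, j + 1), h'⟩
  /-- each unmarked `k` occurs at most once in each column -/
  col_unmarked : ∀ (k : Fin n) (b c : lam.shiftedDiagram), b.1.2 = c.1.2 →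
    T b = Letter.unmarked k → T c = Letter.unmarked k → b = c
  /-- each marked `k'` occurs at most once in each row -/
  row_marked : ∀ (k : Fin n) (b c : lam.shiftedDiagram), b.1.1 = c.1.1 →
    T b = Letter.marked k → T c = Letter.marked k → b = c

open Classical in
/-- The finite set of all marked shifted Young tableaux of shape `lam` and length `n`. -/
noncomputable def markedTableaux (lam : StrictPartition) (n : ℕ) :
    Finset (lam.shiftedDiagram → Letter n) :=
  Finset.univ.filter (IsMarkedTableau lam n)

end MultiparamSchur

open MultiparamSchur

/-! The proof is an induction on the number of variables. On the tableau side, removing the two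
largest letters `n` and `n'` removes a horizontal and then a vertical strip. The symmetrization must
be shown to branch in the same way when the last variable `y` is split off.

The symmetrization is regarded as a multilinear form in the `l` functions `g_i`. Since `(t + s) / (t
- s)` is skew, the form is alternating (`symmForm_swap`): it vanishes on repeated adjacent arguments
and allows row operations. By `symmForm_insert`, if the number of other variables is congruent to
`l` modulo two, deleting `y` amounts to replacing each `g_i(t)` by `(t + y) / (t - y) * (g_i(t) -
g_i(y))`. This rests on the fact that the sum of `ratioProd X` is `0` or `1` according to the parity
of `X.card`. The parity can always be arranged by adjoining the variable `0`, which is harmless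
because `a_1 = 0` makes all the powers vanish there.

For `g_i = 2 (t | a)^{lam_i}` the new function telescopes. Up to a multiple of the function of the
next row, it is a sum over the possible lengths of row `i` once both letters are removed, weighted
by the removed boxes. Multilinearity turns this into a sum over tuples of row lengths, and
alternation discards the tuples that are not strict. An emptied last row carries the function `1`,
which may be dropped under the same parity condition (`symmForm_snoc_one`); hence the value of
`doubledPow` at `m = 0`. The factor `2 ^ l` is absorbed in the doubled powers. -/

namespace MultiparamSchur

/-! ### The symmetrization as an alternating multilinear form. -/

section SymmForm

lemma prod_ratio_swap {K : Type*} [Field K] (X : Finset K) (y : K) :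
    ∏ s ∈ X, (y + s) / (y - s) = (-1) ^ X.card * ∏ s ∈ X, (s + y) / (s - y) := by
  rw [← Finset.prod_const, ← Finset.prod_mul_distrib]
  refine Finset.prod_congr rfl fun s _ => ?_
  rw [neg_one_mul, ← neg_sub s y, div_neg, add_comm]

variable {K : Type*} [Field K] [DecidableEq K]

/-- The product of `(t + s) / (t - s)` over the elements `s ≠ t` of `X`. -/
def ratioProd (X : Finset K) (t : K) : K := ∏ s ∈ X.erase t, (t + s) / (t - s)

/-- The sum over all sequences of `l` distinct elements `t_i` of `X` of
`∏ g_i(t_i) * ∏ (t_i + s) / (t_i - s)`, where `s` runs over `X` without `t_0, ..., t_i`. -/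
noncomputable def symmForm : (l : ℕ) → Finset K → MultilinearMap K (fun _ : Fin l => K → K) K
  | 0, _ => MultilinearMap.constOfIsEmpty K _ 1
  | l + 1, X => ∑ t ∈ X, LinearMap.uncurryLeft
      ((LinearMap.proj t : (K → K) →ₗ[K] K).smulRight (ratioProd X t • symmForm l (X.erase t)))

lemma symmForm_zero (X : Finset K) (g : Fin 0 → K → K) : symmForm 0 X g = 1 := rfl

lemma symmForm_succ (l : ℕ) (X : Finset K) (g : Fin (l + 1) → K → K) :
    symmForm (l + 1) X g =
      ∑ t ∈ X, g 0 t * (ratioProd X t * symmForm l (X.erase t) (Fin.tail g)) := by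
  simp [symmForm]

lemma symmForm_cons (l : ℕ) (X : Finset K) (f : K → K) (g : Fin l → K → K) :
    symmForm (l + 1) X (Fin.cons f g : Fin (l + 1) → K → K) =
      ∑ t ∈ X, f t * (ratioProd X t * symmForm l (X.erase t) g) := by
  simp [symmForm_succ]

lemma symmForm_congr {l : ℕ} {X : Finset K} {g g' : Fin l → K → K}
    (h : ∀ i, ∀ t ∈ X, g i t = g' i t) : symmForm l X g = symmForm l X g' := by
  induction l generalizing X with
  | zero => rfl
  | succ l ih =>
    rw [symmForm_succ, symmForm_succ]
    refine Finset.sum_congr rfl fun t ht => ?_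
    rw [h 0 t ht, ih (g := Fin.tail g) (g' := Fin.tail g') fun i s hs =>
      h i.succ s (Finset.mem_of_mem_erase hs)]

lemma symmForm_eq_zero_of_card_lt {l : ℕ} {X : Finset K} (h : X.card < l) (g : Fin l → K → K) :
    symmForm l X g = 0 := by
  induction l generalizing X with
  | zero => omega
  | succ l ih =>
    rw [symmForm_succ]
    refine Finset.sum_eq_zero fun t ht => ?_
    rw [ih (by rw [Finset.card_erase_of_mem ht]; have := Finset.card_pos.2 ⟨t, ht⟩; omega)]
    simp

lemma ratioProd_eq_mul {X : Finset K} {s t : K} (hs : s ∈ X) (hst : s ≠ t) :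
    ratioProd X t = (t + s) / (t - s) * ratioProd (X.erase s) t := by
  rw [ratioProd, ratioProd, Finset.erase_right_comm,
    Finset.mul_prod_erase (X.erase t) (fun s => (t + s) / (t - s)) (Finset.mem_erase.2 ⟨hst, hs⟩)]

lemma ratioProd_insert {X : Finset K} {s t : K} (hs : s ∉ X) (hst : s ≠ t) :
    ratioProd (insert s X) t = (t + s) / (t - s) * ratioProd X t := by
  rw [ratioProd_eq_mul (Finset.mem_insert_self s X) hst, Finset.erase_insert hs]

lemma ratioProd_insert_self {X : Finset K} {t : K} (ht : t ∉ X) :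
    ratioProd (insert t X) t = ∏ s ∈ X, (t + s) / (t - s) := by
  rw [ratioProd, Finset.erase_insert ht]

/-- The elements `t` and `s` fed to the first two arguments occur in both orders. Of the ratio
factors only the mutual one, `(t + s) / (t - s)`, depends on the order, and it changes sign. -/
lemma symmForm_swap (l : ℕ) (X : Finset K) (f g : K → K) (h : Fin l → K → K) :
    symmForm (l + 2) X (Fin.cons f (Fin.cons g h : Fin (l + 1) → K → K)) =
      -symmForm (l + 2) X (Fin.cons g (Fin.cons f h : Fin (l + 1) → K → K)) := by
  have key : ∀ f g : K → K,
      symmForm (l + 2) X (Fin.cons f (Fin.cons g h : Fin (l + 1) → K → K)) =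
      ∑ t ∈ X, ∑ s ∈ X, if s ≠ t then f t * g s * ((t + s) / (t - s)) *
        (ratioProd (X.erase s) t * ratioProd (X.erase t) s *
          symmForm l ((X.erase t).erase s) h) else 0 := by
    intro f g
    rw [symmForm_cons]
    refine Finset.sum_congr rfl fun t ht => ?_
    rw [symmForm_cons, ← Finset.sum_filter, Finset.filter_ne', Finset.mul_sum, Finset.mul_sum]
    refine Finset.sum_congr rfl fun s hs => ?_
    rw [Finset.mem_erase] at hs
    rw [ratioProd_eq_mul hs.2 hs.1]
    ring
  rw [key, key, Finset.sum_comm, ← Finset.sum_neg_distrib]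
  refine Finset.sum_congr rfl fun t _ => ?_
  rw [← Finset.sum_neg_distrib]
  refine Finset.sum_congr rfl fun s _ => ?_
  by_cases hst : s = t
  · simp [hst]
  · rw [if_pos (Ne.symm hst), if_pos hst, Finset.erase_right_comm (a := s), ← neg_sub t s, div_neg]
    ring

variable [CharZero K]

lemma symmForm_cons_cons_self (l : ℕ) (X : Finset K) (f : K → K) (h : Fin l → K → K) :
    symmForm (l + 2) X (Fin.cons f (Fin.cons f h : Fin (l + 1) → K → K)) = 0 :=
  self_eq_neg.1 (symmForm_swap l X f f h)

lemma symmForm_eq_zero_of_adjacent {l : ℕ} (X : Finset K) (g : Fin (l + 1) → K → K) (i : Fin l)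
    (h : g i.castSucc = g i.succ) : symmForm (l + 1) X g = 0 := by
  induction l generalizing X with
  | zero => exact i.elim0
  | succ l ih =>
    induction i using Fin.cases with
    | zero =>
      rw [← Fin.cons_self_tail g, ← Fin.cons_self_tail (Fin.tail g)]
      have : Fin.tail g 0 = g 0 := h.symm
      rw [this]
      exact symmForm_cons_cons_self _ _ _ _
    | succ i =>
      rw [symmForm_succ]
      refine Finset.sum_eq_zero fun t _ => ?_
      rw [ih (X.erase t) (Fin.tail g) i h]
      simp

/-- Subtracting from each argument a multiple of the next one does not change `symmForm`. -/
lemma symmForm_sub_smul_next (l : ℕ) (X : Finset K) (G : ℕ → K → K) (d : ℕ → K)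
    (hG : G l = 0) :
    symmForm l X (fun i => G i - d i • G (i + 1)) = symmForm l X (fun i => G i) := by
  induction l generalizing X G d with
  | zero => rfl
  | succ l ih =>
    have h1 : symmForm (l + 1) X (fun i => G i - d i • G (i + 1)) =
        symmForm (l + 1) X (Fin.cons (G 0 - d 0 • G 1) fun i : Fin l => G (i + 1)) := by
      rw [symmForm_succ, symmForm_succ]
      refine Finset.sum_congr rfl fun t _ => ?_
      have := ih (X.erase t) (fun i => G (i + 1)) (fun i => d (i + 1)) hG
      simp only [Fin.tail_cons, Fin.cons_zero]
      rw [← this]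
      rfl
    have h2 : (fun i : Fin (l + 1) => G i) =
        (Fin.cons (G 0) fun i : Fin l => G (i + 1) : Fin (l + 1) → K → K) := by
      ext i; induction i using Fin.cases <;> simp
    -- This is the term created by the row operation on the head: its first two arguments coincide,
    -- or, with a single slot, its only argument is `G l = 0`.
    have h3 : symmForm (l + 1) X (Fin.cons (G 1) fun i : Fin l => G (i + 1)) = 0 := by
      rcases l with _ | l
      · rw [symmForm_cons]; simp [hG]
      · refine symmForm_eq_zero_of_adjacent X _ 0 ?_
        simp
    rw [h1, h2, symmForm_cons, symmForm_cons]
    rw [symmForm_cons] at h3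
    simp only [Pi.sub_apply, Pi.smul_apply, smul_eq_mul, sub_mul, Finset.sum_sub_distrib, mul_assoc]
    rw [← Finset.mul_sum, h3]
    simp

end SymmForm

/-! ### Parity identities for the ratio products, and removal of a variable. -/

section RatioIdentities

-- Lagrange interpolation of `∏ (X + s) - ∏ (X - s)` at the points of `X`, evaluated at `0`. Both
-- products are monic, so the difference has degree less than `X.card`; at `t` only the first
-- product survives, and its factor `2 * t` completes `∏ s`, which is then cancelled.
open Polynomial in
lemma two_mul_sum_ratioProd_of_zero_notMem {K : Type*} [Field K] [DecidableEq K] {X : Finset K}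
    (h0 : (0 : K) ∉ X) : 2 * ∑ t ∈ X, ratioProd X t = 1 - (-1) ^ X.card := by
  rcases X.eq_empty_or_nonempty with rfl | hne
  · simp
  set p : K[X] := ∏ s ∈ X, (Polynomial.X + C s)
  set q : K[X] := ∏ s ∈ X, (Polynomial.X - C s)
  have hp : p.Monic := monic_prod_of_monic _ _ fun s _ => monic_X_add_C s
  have hq : q.Monic := monic_prod_of_monic _ _ fun s _ => monic_X_sub_C s
  have dp : p.degree = X.card := by
    rw [degree_eq_natDegree hp.ne_zero, natDegree_prod_of_monic _ _ fun s _ => monic_X_add_C s]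
    simp
  have dq : q.degree = X.card := by
    rw [degree_eq_natDegree hq.ne_zero, natDegree_prod_of_monic _ _ fun s _ => monic_X_sub_C s]
    simp
  have hd : (p - q).degree < X.card := by
    rw [← dp]
    exact degree_sub_lt_left (dp.trans dq.symm) hp.ne_zero (hp.leadingCoeff.trans hq.leadingCoeff.symm)
  have h := congrArg (eval 0) (Lagrange.eq_interpolate (v := id) (Set.injOn_id _) hd)
  rw [Lagrange.interpolate_apply, eval_finsetSum] at h
  have hterm : ∀ t ∈ X, eval 0 (C (eval (id t) (p - q)) * Lagrange.basis X id t) =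
      -((-1) ^ X.card * (∏ s ∈ X, s) * (2 * ratioProd X t)) := by
    intro t ht
    have hq0 : eval t q = 0 := by
      rw [eval_prod]
      exact Finset.prod_eq_zero ht (by simp)
    have hp0 : eval t p = 2 * t * ∏ s ∈ X.erase t, (t + s) := by
      rw [eval_prod, ← Finset.mul_prod_erase _ _ ht]
      simp [two_mul]
    have hb : eval 0 (Lagrange.basis X id t) = ∏ s ∈ X.erase t, (-1) * (s * (t - s)⁻¹) := by
      rw [Lagrange.basis, eval_prod]
      refine Finset.prod_congr rfl fun s _ => ?_
      simp [Lagrange.basisDivisor]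
      ring
    rw [eval_mul, eval_C, eval_sub, id, hq0, hp0, hb, Finset.prod_mul_distrib, Finset.prod_const,
      Finset.prod_mul_distrib, ratioProd, ← Finset.mul_prod_erase _ _ ht, sub_zero]
    simp only [div_eq_mul_inv]
    rw [Finset.prod_mul_distrib, ← Finset.card_erase_add_one ht, pow_succ]
    ring
  rw [Finset.sum_congr rfl hterm, Finset.sum_neg_distrib, ← Finset.mul_sum, ← Finset.mul_sum,
    eval_sub, eval_prod, eval_prod] at h
  have hprod : (∏ s ∈ X, s) ≠ 0 := Finset.prod_ne_zero_iff.2 fun s hs hs0 => h0 (hs0 ▸ hs)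
  have h2 : ∏ s ∈ X, eval 0 (Polynomial.X - C s) = (-1) ^ X.card * ∏ s ∈ X, s := by
    rw [← Finset.prod_const, ← Finset.prod_mul_distrib]
    exact Finset.prod_congr rfl fun s _ => by simp
  have h3 : ∏ s ∈ X, eval 0 (Polynomial.X + C s) = ∏ s ∈ X, s :=
    Finset.prod_congr rfl fun s _ => by simp
  rw [h2, h3] at h
  have hs : ((-1 : K) ^ X.card) * (-1) ^ X.card = 1 := by
    rw [← mul_pow]; simp
  have h4 : (∏ s ∈ X, s) * (2 * ∑ t ∈ X, ratioProd X t) =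
      (∏ s ∈ X, s) * (1 - (-1) ^ X.card) := by
    linear_combination (-1) ^ X.card * h + (∏ s ∈ X, s) * (1 - 2 * ∑ t ∈ X, ratioProd X t) * hs
  exact mul_left_cancel₀ hprod h4

variable {K : Type*} [Field K] [DecidableEq K]

lemma sum_ratioProd_insert_zero {X : Finset K} (h0 : (0 : K) ∉ X) :
    ∑ t ∈ insert 0 X, ratioProd (insert 0 X) t = (-1) ^ X.card + ∑ t ∈ X, ratioProd X t := by
  have hX : ∀ t ∈ X, t ≠ 0 := fun t ht h => h0 (h ▸ ht)
  rw [Finset.sum_insert h0, ratioProd_insert_self h0]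
  congr 1
  · rw [← Finset.prod_const]
    refine Finset.prod_congr rfl fun s hs => ?_
    have := hX s hs
    rw [zero_add, zero_sub, div_neg, div_self this]
  · refine Finset.sum_congr rfl fun t ht => ?_
    rw [ratioProd_insert h0 (hX t ht).symm, add_zero, sub_zero, div_self (hX t ht), one_mul]

/-- Stability: `0` contributes nothing when chosen as an argument, and otherwise only factors `(t +
0) / (t - 0) = 1`. -/
lemma symmForm_insert_zero (l : ℕ) {X : Finset K} (h0 : (0 : K) ∉ X) (g : Fin l → K → K)
    (hg : ∀ i, g i 0 = 0) : symmForm l (insert 0 X) g = symmForm l X g := by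
  induction l generalizing X with
  | zero => rfl
  | succ l ih =>
    rw [symmForm_succ, symmForm_succ, Finset.sum_insert h0, hg, zero_mul, zero_add]
    refine Finset.sum_congr rfl fun t ht => ?_
    have h0t : (0 : K) ≠ t := fun e => h0 (e ▸ ht)
    rw [ratioProd_insert h0 h0t, Finset.erase_insert_of_ne h0t,
      ih (fun h => h0 (Finset.mem_of_mem_erase h)) (Fin.tail g) fun i => hg i.succ,
      add_zero, sub_zero, div_self h0t.symm, one_mul]

variable [CharZero K]

lemma sum_ratioProd_of_even {X : Finset K} (h : Even X.card) : ∑ t ∈ X, ratioProd X t = 0 := by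
  by_cases h0 : (0 : K) ∈ X
  · have hc := Finset.card_erase_add_one h0
    have ho : Odd (X.erase 0).card := by
      rw [← hc] at h
      exact Nat.not_even_iff_odd.1 (Nat.even_add_one.1 h)
    have h1 := two_mul_sum_ratioProd_of_zero_notMem (Finset.notMem_erase (0 : K) X)
    have h2 := sum_ratioProd_insert_zero (Finset.notMem_erase (0 : K) X)
    rw [Finset.insert_erase h0, ho.neg_one_pow] at h2
    rw [ho.neg_one_pow] at h1
    have : (2 : K) ≠ 0 := two_ne_zero
    apply mul_left_cancel₀ this
    linear_combination 2 * h2 + h1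
  · have h1 := two_mul_sum_ratioProd_of_zero_notMem h0
    rw [h.neg_one_pow] at h1
    simpa using h1

lemma sum_ratioProd_of_odd {X : Finset K} (h : Odd X.card) : ∑ t ∈ X, ratioProd X t = 1 := by
  by_cases h0 : (0 : K) ∈ X
  · have hc := Finset.card_erase_add_one h0
    have he : Even (X.erase 0).card := by
      rw [← hc] at h
      exact Nat.not_odd_iff_even.1 (Nat.odd_add_one.1 h)
    have h1 := sum_ratioProd_of_even he
    have h2 := sum_ratioProd_insert_zero (Finset.notMem_erase (0 : K) X)
    rw [Finset.insert_erase h0, he.neg_one_pow, h1] at h2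
    simpa using h2
  · have h1 := two_mul_sum_ratioProd_of_zero_notMem h0
    rw [h.neg_one_pow] at h1
    have : (2 : K) ≠ 0 := two_ne_zero
    apply mul_left_cancel₀ this
    linear_combination h1

/-- This is the vanishing sum for the even set `insert y X`, with the term of `y` moved to the other
side. -/
lemma sum_ratio_mul_ratioProd_of_odd {X : Finset K} {y : K} (hy : y ∉ X) (h : Odd X.card) :
    ∑ t ∈ X, (t + y) / (t - y) * ratioProd X t = ∏ t ∈ X, (t + y) / (t - y) := by
  have h1 := sum_ratioProd_of_even (X := insert y X)
    (by rw [Finset.card_insert_of_notMem hy]; exact h.add_one)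
  rw [Finset.sum_insert hy, ratioProd_insert_self hy, prod_ratio_swap, h.neg_one_pow] at h1
  have h2 : ∑ t ∈ X, ratioProd (insert y X) t = ∑ t ∈ X, (t + y) / (t - y) * ratioProd X t :=
    Finset.sum_congr rfl fun t ht => ratioProd_insert hy fun e => hy (e ▸ ht)
  rw [← h2]
  linear_combination h1

/-- Evaluates the correction term in `symmForm_insert`. The constant `g 0 y` in the second slot
contributes a multiple of the head and drops out by alternation; after a swap the ratio is again the
head of a form with one variable and one argument fewer. -/
lemma symmForm_cons_ratio (l : ℕ) {X : Finset K} {y : K} (hy : y ∉ X) (h : Even (X.card + l + 1))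
    (g : Fin l → K → K) :
    symmForm (l + 1) X (Fin.cons (fun t => (t + y) / (t - y))
        fun i t => (t + y) / (t - y) * (g i t - g i y)) =
      (-1) ^ l * (∏ t ∈ X, (t + y) / (t - y)) * symmForm l X g := by
  induction l generalizing X with
  | zero =>
    rw [symmForm_cons, symmForm_zero]
    have ho : Odd X.card := by
      have := Nat.even_add_one.1 h
      simpa using this
    rw [← sum_ratio_mul_ratioProd_of_odd hy ho]
    simp [symmForm_zero]
  | succ l ih =>
    set c : K → K := fun t => (t + y) / (t - y)
    set r : Fin l → K → K := fun i t => c t * (g i.succ t - g i.succ y)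
    have h1 : (fun (i : Fin (l + 1)) t => c t * (g i t - g i y)) =
        Fin.cons (c * g 0 + (-g 0 y) • c) r := by
      ext i t
      induction i using Fin.cases with
      | zero => simp; ring
      | succ i => simp [r]
    have hadd : ∀ f : K → K, symmForm (l + 2) X
        (Fin.cons f (Fin.cons (c * g 0 + (-g 0 y) • c) r : Fin (l + 1) → K → K)) =
        symmForm (l + 2) X (Fin.cons f (Fin.cons (c * g 0) r : Fin (l + 1) → K → K)) +
        -g 0 y * symmForm (l + 2) X (Fin.cons f (Fin.cons c r : Fin (l + 1) → K → K)) := by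
      intro f
      simp only [symmForm_cons (l + 1)]
      rw [Finset.mul_sum, ← Finset.sum_add_distrib]
      refine Finset.sum_congr rfl fun t _ => ?_
      rw [MultilinearMap.cons_add, MultilinearMap.cons_smul]
      simp only [smul_eq_mul]
      ring
    rw [h1, hadd, symmForm_cons_cons_self, symmForm_swap, symmForm_cons, symmForm_succ l,
      mul_zero, add_zero, Finset.mul_sum, ← Finset.sum_neg_distrib]
    refine Finset.sum_congr rfl fun t ht => ?_
    have ih' : symmForm (l + 1) (X.erase t) (Fin.cons c r) = _ :=
      ih (fun h => hy (Finset.mem_of_mem_erase h))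
        (by rw [← Finset.card_erase_add_one ht] at h
            have : (X.erase t).card + 1 + (l + 1) + 1 = (X.erase t).card + l + 1 + 2 := by ring
            rw [this] at h
            simpa [Nat.even_add] using h) (Fin.tail g)
    rw [ih', ← Finset.mul_prod_erase X _ ht, pow_succ]
    simp only [Pi.mul_apply]
    ring

/-- Removing one variable from `symmForm`, for `l` congruent to the number of remaining
variables modulo two. -/
theorem symmForm_insert (l : ℕ) {X : Finset K} {y : K} (hy : y ∉ X) (h : Even (X.card + l))
    (g : Fin l → K → K) :
    symmForm l (insert y X) g =
      symmForm l X fun i t => (t + y) / (t - y) * (g i t - g i y) := by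
  induction l generalizing X with
  | zero => rfl
  | succ l ih =>
    set c : K → K := fun t => (t + y) / (t - y)
    set r : Fin l → K → K := fun i t => c t * (g i.succ t - g i.succ y)
    have h1 : (fun (i : Fin (l + 1)) t => c t * (g i t - g i y)) =
        Fin.cons (c * g 0 + (-g 0 y) • c) r := by
      ext i t
      induction i using Fin.cases with
      | zero => simp; ring
      | succ i => simp [r]
    have h2 := symmForm_cons_ratio l hy (by rwa [add_assoc]) (Fin.tail g)
    -- Here parity enters: reversing the ratios in the term `t = y` costs `(-1) ^ X.card`, which
    -- must match the sign in `h2` of the part of the first argument containing `g 0 y`.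
    have hsign : (-1 : K) ^ X.card = -(-1) ^ l := by
      have : (-1 : K) ^ X.card * (-1) ^ (l + 1) = 1 := by rw [← pow_add, h.neg_one_pow]
      have h3 : (-1 : K) ^ l * (-1) ^ l = 1 := by rw [← mul_pow]; simp
      rw [pow_succ] at this
      linear_combination (-(-1) ^ l) * this - (-1) ^ X.card * h3
    rw [h1, MultilinearMap.cons_add, MultilinearMap.cons_smul]
    erw [h2]
    rw [symmForm_cons, symmForm_succ, Finset.sum_insert hy, ratioProd_insert_self hy,
      Finset.erase_insert hy, prod_ratio_swap, hsign]
    have h4 : ∑ t ∈ X, g 0 t * (ratioProd (insert y X) t *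
          symmForm l ((insert y X).erase t) (Fin.tail g)) =
        ∑ t ∈ X, (c * g 0) t * (ratioProd X t * symmForm l (X.erase t) r) := by
      refine Finset.sum_congr rfl fun t ht => ?_
      have hty : y ≠ t := fun e => hy (e ▸ ht)
      rw [ratioProd_insert hy hty, Finset.erase_insert_of_ne hty,
        ih (fun h => hy (Finset.mem_of_mem_erase h))
          (by rw [← Finset.card_erase_add_one ht] at h
              have : (X.erase t).card + 1 + (l + 1) = (X.erase t).card + l + 2 := by ring
              rw [this] at h
              simpa [Nat.even_add] using h)]
      simp only [Pi.mul_apply, c, r, Fin.tail]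
      ring
    rw [h4, smul_eq_mul]
    ring

/-- When the last argument is reached, an odd number of elements is left, so the innermost sum of
`ratioProd` is `1`. -/
lemma symmForm_snoc_one (l : ℕ) {X : Finset K} (h : Even (X.card + l + 1))
    (g : Fin (l + 1) → K → K) (hg : g (Fin.last l) = 1) :
    symmForm (l + 1) X g = symmForm l X (Fin.init g) := by
  induction l generalizing X with
  | zero =>
    have ho : Odd X.card := by
      have := Nat.even_add_one.1 h
      simpa using this
    rw [symmForm_succ, symmForm_zero, ← sum_ratioProd_of_odd ho]
    refine Finset.sum_congr rfl fun t _ => ?_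
    have : g 0 = 1 := hg
    simp [this, symmForm_zero]
  | succ l ih =>
    rw [symmForm_succ, symmForm_succ]
    refine Finset.sum_congr rfl fun t ht => ?_
    rw [ih (by rw [← Finset.card_erase_add_one ht] at h
               have : (X.erase t).card + 1 + (l + 1) + 1 = (X.erase t).card + l + 1 + 2 := by ring
               rw [this] at h
               simpa [Nat.even_add] using h) (Fin.tail g) hg]
    rfl

end RatioIdentities

/-! ### Tableaux as chains of strips. -/

section StripSum

/-- `D` is obtained from its part `D'` by adding boxes with the letter `N`, which is larger than
all letters in `D'` and may be repeated in rows if `N` is odd and in columns if `N` is even. -/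
def IsStrip (N : ℕ) (D' D : Finset (ℕ × ℕ)) : Prop :=
  D' ⊆ D ∧ ∀ b ∈ D, b ∉ D' → ∀ c ∈ D,
    (b.1 = c.1 → b.2 < c.2 → c ∉ D' ∧ Odd N) ∧ (b.2 = c.2 → b.1 < c.1 → c ∉ D' ∧ Even N)

/-- A filling of `D` with weakly increasing rows and columns, in which odd letters do not repeat
in columns and even letters do not repeat in rows. -/
def IsParityTableau (D : Finset (ℕ × ℕ)) (T : D → ℕ) : Prop :=
  ∀ b c : D, (b.1.1 = c.1.1 → b.1.2 < c.1.2 → T b ≤ T c ∧ (T b = T c → Odd (T b))) ∧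
    (b.1.2 = c.1.2 → b.1.1 < c.1.1 → T b ≤ T c ∧ (T b = T c → Even (T b)))

variable {R : Type*} [CommRing R]

open Classical in
/-- The sum over chains of strips, which add the letters `0, ..., N - 1`. -/
noncomputable def stripSum (wt : ℕ → ℕ × ℕ → R) : ℕ → Finset (ℕ × ℕ) → R
  | 0, D => if D = ∅ then 1 else 0
  | N + 1, D => ∑ D' ∈ D.powerset with IsStrip N D' D,
      (∏ b ∈ D \ D', wt N b) * stripSum wt N D'

/-- The restriction of a filling of `D` to its part `D'`. -/
def restrictFilling {D D' : Finset (ℕ × ℕ)} (hD : D' ⊆ D) (T : D → ℕ) : D' → ℕ :=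
  fun b => T ⟨b.1, hD b.2⟩

/-- The filling of `D` by `N` outside its part `D'`, and by a given filling on `D'`. -/
def extendFilling (N : ℕ) (D : Finset (ℕ × ℕ)) {D' : Finset (ℕ × ℕ)} (T : D' → ℕ) : D → ℕ :=
  fun b => if hb : b.1 ∈ D' then T ⟨b.1, hb⟩ else N

lemma extendFilling_of_mem {N : ℕ} {D D' : Finset (ℕ × ℕ)} (T : D' → ℕ) {b : D}
    (hb : b.1 ∈ D') : extendFilling N D T b = T ⟨b.1, hb⟩ := dif_pos hb

lemma extendFilling_of_notMem {N : ℕ} {D D' : Finset (ℕ × ℕ)} (T : D' → ℕ) {b : D}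
    (hb : b.1 ∉ D') : extendFilling N D T b = N := dif_neg hb

/-- The part of `D` which carries letters less than `N`. -/
def sublevelShape (N : ℕ) {D : Finset (ℕ × ℕ)} (T : D → ℕ) : Finset (ℕ × ℕ) :=
  (Finset.univ.filter fun b : D => T b < N).map (Function.Embedding.subtype _)

lemma mem_sublevelShape {N : ℕ} {D : Finset (ℕ × ℕ)} (T : D → ℕ) (b : D) :
    b.1 ∈ sublevelShape N T ↔ T b < N := by
  simp [sublevelShape]

lemma sublevelShape_subset {N : ℕ} {D : Finset (ℕ × ℕ)} (T : D → ℕ) :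
    sublevelShape N T ⊆ D := by
  intro b hb
  simp only [sublevelShape, Finset.mem_map] at hb
  obtain ⟨c, -, rfl⟩ := hb
  exact c.2

lemma sublevelShape_extendFilling {N : ℕ} {D D' : Finset (ℕ × ℕ)} (hD : D' ⊆ D) {T : D' → ℕ}
    (hT : ∀ b, T b < N) : sublevelShape N (extendFilling N D T) = D' := by
  ext b
  constructor
  · intro h
    have h1 := (mem_sublevelShape _ ⟨b, sublevelShape_subset _ h⟩).1 h
    by_contra hb
    rw [extendFilling_of_notMem _ hb] at h1
    exact lt_irrefl _ h1
  · intro hb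
    refine (mem_sublevelShape _ ⟨b, hD hb⟩).2 ?_
    rw [extendFilling_of_mem _ hb]
    exact hT _

lemma extendFilling_restrictFilling {N : ℕ} {D D' : Finset (ℕ × ℕ)} (hD : D' ⊆ D) {T : D → ℕ}
    (hT : ∀ b, T b < N + 1) (h : sublevelShape N T = D') :
    extendFilling N D (restrictFilling hD T) = T := by
  ext b
  by_cases hb : b.1 ∈ D'
  · rw [extendFilling_of_mem _ hb]
    rfl
  · rw [extendFilling_of_notMem _ hb]
    rw [← h, mem_sublevelShape] at hb
    have := hT b
    omega

lemma restrictFilling_extendFilling {N : ℕ} {D D' : Finset (ℕ × ℕ)} (hD : D' ⊆ D) (T : D' → ℕ) :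
    restrictFilling hD (extendFilling N D T) = T := by
  ext b
  exact extendFilling_of_mem T b.2

lemma prod_extendFilling (wt : ℕ → ℕ × ℕ → R) {N : ℕ} {D D' : Finset (ℕ × ℕ)} (hD : D' ⊆ D)
    (T : D' → ℕ) : ∏ b : D, wt (extendFilling N D T b) b =
      (∏ b ∈ D \ D', wt N b) * ∏ b : D', wt (T b) b := by
  set e : ℕ × ℕ → R := fun b => if hb : b ∈ D' then wt (T ⟨b, hb⟩) b else wt N b
  have h1 : ∏ b : D, wt (extendFilling N D T b) b = ∏ b : D, e b := by
    refine Finset.prod_congr rfl fun b _ => ?_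
    simp only [e, extendFilling]
    split_ifs <;> rfl
  rw [h1, Finset.prod_coe_sort D e, ← Finset.prod_sdiff hD, ← Finset.prod_coe_sort D' e]
  congr 1
  · refine Finset.prod_congr rfl fun b hb => ?_
    simp [e, (Finset.mem_sdiff.1 hb).2]
  · refine Finset.prod_congr rfl fun b _ => ?_
    simp [e]

lemma isParityTableau_restrict {N : ℕ} {D D' : Finset (ℕ × ℕ)} {T : D → ℕ} (hD : D' ⊆ D)
    (hT : IsParityTableau D T) (hN : ∀ b, T b < N + 1) (h : ∀ b : D, b.1 ∈ D' ↔ T b < N) :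
    IsParityTableau D' (restrictFilling hD T) ∧ IsStrip N D' D := by
  refine ⟨fun b c => hT ⟨b.1, hD b.2⟩ ⟨c.1, hD c.2⟩, hD, fun b hb hb' c hc => ?_⟩
  have hbN : T ⟨b, hb⟩ = N := by
    have h1 := hN ⟨b, hb⟩
    have h2 := mt (h ⟨b, hb⟩).2 hb'
    omega
  have hcN := hN ⟨c, hc⟩
  have hc' := h ⟨c, hc⟩
  have hbc := hT ⟨b, hb⟩ ⟨c, hc⟩
  rw [hbN] at hbc
  refine ⟨fun h1 h2 => ?_, fun h1 h2 => ?_⟩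
  · have h3 := hbc.1 h1 h2
    exact ⟨fun hcD => by have := hc'.1 hcD; omega, h3.2 (by omega)⟩
  · have h3 := hbc.2 h1 h2
    exact ⟨fun hcD => by have := hc'.1 hcD; omega, h3.2 (by omega)⟩

lemma isParityTableau_extend {N : ℕ} {D D' : Finset (ℕ × ℕ)} {T : D' → ℕ}
    (hT : IsParityTableau D' T) (hN : ∀ b, T b < N) (h : IsStrip N D' D) :
    IsParityTableau D (extendFilling N D T) := by
  intro b c
  simp only [extendFilling]
  have hbc := h.2 b.1 b.2
  by_cases hb : b.1 ∈ D' <;> by_cases hc : c.1 ∈ D'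
  · simpa [hb, hc] using hT ⟨b, hb⟩ ⟨c, hc⟩
  · have := hN ⟨b, hb⟩
    simp only [hb, hc, dite_true, dite_false]
    exact ⟨fun _ _ => ⟨by omega, fun h => by omega⟩, fun _ _ => ⟨by omega, fun h => by omega⟩⟩
  · have := hbc hb c.1 c.2
    exact ⟨fun h1 h2 => absurd hc (this.1 h1 h2).1, fun h1 h2 => absurd hc (this.2 h1 h2).1⟩
  · have := hbc hb c.1 c.2
    simp only [hb, hc, dite_false]
    exact ⟨fun h1 h2 => ⟨le_rfl, fun _ => (this.1 h1 h2).2⟩,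
      fun h1 h2 => ⟨le_rfl, fun _ => (this.2 h1 h2).2⟩⟩

-- A filling with letters below `N + 1` is the same as the shape `D'` of its letters below `N`, a
-- filling of `D'`, and a strip outside `D'` that carries only `N`.
open Classical in
theorem sum_parityTableau (wt : ℕ → ℕ × ℕ → R) (N : ℕ) (D : Finset (ℕ × ℕ)) :
    ∑ T ∈ Fintype.piFinset (fun _ : D => Finset.range N) with IsParityTableau D T,
      ∏ b : D, wt (T b) b = stripSum wt N D := by
  induction N generalizing D with
  | zero =>
    rw [stripSum]
    split_ifs with hD
    · subst hD
      rw [Finset.filter_true_of_mem fun T _ b => absurd b.2 (Finset.notMem_empty _)]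
      simp
    · obtain ⟨b, hb⟩ := Finset.nonempty_iff_ne_empty.2 hD
      refine Finset.sum_eq_zero fun T hT => ?_
      have := Fintype.mem_piFinset.1 (Finset.mem_filter.1 hT).1 ⟨b, hb⟩
      simp at this
  | succ N ih =>
    rw [stripSum]
    rw [← Finset.sum_fiberwise_of_maps_to (g := sublevelShape N)
      (t := D.powerset.filter fun D' => IsStrip N D' D)]
    · refine Finset.sum_congr rfl fun D' hD' => ?_
      rw [Finset.mem_filter, Finset.mem_powerset] at hD'
      rw [← ih, Finset.mul_sum]
      refine Finset.sum_bij' (fun T _ => restrictFilling hD'.1 T)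
        (fun T _ => extendFilling N D T) ?_ ?_ ?_ ?_ ?_
      · intro T hT
        simp only [Finset.mem_filter, Fintype.mem_piFinset, Finset.mem_range] at hT ⊢
        have hT' : ∀ b : D, b.1 ∈ D' ↔ T b < N :=
          fun b => by rw [← hT.2]; exact mem_sublevelShape T b
        exact ⟨fun b => (hT' ⟨b.1, hD'.1 b.2⟩).1 b.2,
          (isParityTableau_restrict hD'.1 hT.1.2 hT.1.1 hT').1⟩
      · intro T hT
        simp only [Finset.mem_filter, Fintype.mem_piFinset, Finset.mem_range] at hT ⊢
        refine ⟨⟨fun b => ?_, isParityTableau_extend hT.2 hT.1 hD'.2⟩,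
          sublevelShape_extendFilling hD'.1 hT.1⟩
        rw [extendFilling]
        split_ifs with hb
        · exact (hT.1 ⟨b.1, hb⟩).trans N.lt_succ_self
        · exact N.lt_succ_self
      · intro T hT
        simp only [Finset.mem_filter, Fintype.mem_piFinset, Finset.mem_range] at hT
        exact extendFilling_restrictFilling hD'.1 hT.1.1 hT.2
      · exact fun T _ => restrictFilling_extendFilling hD'.1 T
      · intro T hT
        simp only [Finset.mem_filter, Fintype.mem_piFinset, Finset.mem_range] at hT
        rw [← prod_extendFilling wt hD'.1, extendFilling_restrictFilling hD'.1 hT.1.1 hT.2]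
    · intro T hT
      simp only [Finset.mem_filter, Fintype.mem_piFinset, Finset.mem_range] at hT
      rw [Finset.mem_filter, Finset.mem_powerset]
      exact ⟨sublevelShape_subset T, (isParityTableau_restrict (sublevelShape_subset T) hT.2 hT.1
        (mem_sublevelShape T)).2⟩

end StripSum

/-! ### Shifted diagrams described by their row lengths. -/

section ShiftedShape

/-- The shifted diagram with rows of lengths `mu i`; rows and columns are numbered from one. -/
def shiftedShape {l : ℕ} (mu : Fin l → ℕ) : Finset (ℕ × ℕ) :=
  Finset.univ.biUnion fun i : Fin l => {(i : ℕ) + 1} ×ˢ Finset.Icc ((i : ℕ) + 1) (mu i + i)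

variable {l : ℕ}

lemma mem_shiftedShape {mu : Fin l → ℕ} {b : ℕ × ℕ} :
    b ∈ shiftedShape mu ↔ ∃ i : Fin l, b.1 = i + 1 ∧ (i : ℕ) + 1 ≤ b.2 ∧ b.2 ≤ mu i + i := by
  simp only [shiftedShape, Finset.mem_biUnion, Finset.mem_univ, true_and, Finset.mem_product,
    Finset.mem_singleton, Finset.mem_Icc]

lemma mk_mem_shiftedShape {mu : Fin l → ℕ} {i : Fin l} {c : ℕ} :
    ((i : ℕ) + 1, c) ∈ shiftedShape mu ↔ (i : ℕ) + 1 ≤ c ∧ c ≤ mu i + i := by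
  rw [mem_shiftedShape]
  constructor
  · rintro ⟨j, h1, h2⟩
    have : i = j := Fin.ext (by simpa using h1)
    exact this ▸ h2
  · exact fun h => ⟨i, rfl, h⟩

lemma shiftedShape_subset_iff {mu nu : Fin l → ℕ} :
    shiftedShape mu ⊆ shiftedShape nu ↔ ∀ i, mu i ≤ nu i := by
  constructor
  · intro h i
    by_contra hi
    have h1 : ((i : ℕ) + 1, mu i + i) ∈ shiftedShape mu :=
      mk_mem_shiftedShape.2 ⟨by omega, le_rfl⟩
    have := mk_mem_shiftedShape.1 (h h1)
    omega
  · rintro h ⟨r, c⟩ hb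
    obtain ⟨i, rfl, h1, h2⟩ := mem_shiftedShape.1 hb
    exact mk_mem_shiftedShape.2 ⟨h1, h2.trans (by have := h i; omega)⟩

lemma shiftedShape_injective : Function.Injective (shiftedShape : (Fin l → ℕ) → _) := by
  intro mu nu h
  ext i
  exact le_antisymm (shiftedShape_subset_iff.1 h.le i) (shiftedShape_subset_iff.1 h.ge i)

lemma shiftedShape_init {mu : Fin (l + 1) → ℕ} (h : mu (Fin.last l) = 0) :
    shiftedShape (Fin.init mu) = shiftedShape mu := by
  ext ⟨r, c⟩
  constructor
  · intro hb
    obtain ⟨i, rfl, h1, h2⟩ := mem_shiftedShape.1 hb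
    exact (mk_mem_shiftedShape (i := i.castSucc)).2 ⟨h1, h2⟩
  · intro hb
    obtain ⟨i, rfl, h1, h2⟩ := mem_shiftedShape.1 hb
    induction i using Fin.lastCases with
    | last => simp [h] at h1 h2; omega
    | cast i => exact mk_mem_shiftedShape.2 ⟨h1, h2⟩

lemma prod_shiftedShape_sdiff {R : Type*} [CommRing R] {mu nu : Fin l → ℕ}
    (wt : ℕ × ℕ → R) (F : ℕ → R)
    (hwt : ∀ r c, r ≤ c → wt (r, c) = F (c - r + 1)) :
    ∏ b ∈ shiftedShape nu \ shiftedShape mu, wt b =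
      ∏ i, ∏ k ∈ Finset.Icc (mu i + 1) (nu i), F k := by
  rw [Finset.prod_sigma' Finset.univ]
  symm
  refine Finset.prod_bij (fun p _ => ((p.1 : ℕ) + 1, p.2 + p.1)) ?_ ?_ ?_ ?_
  · rintro ⟨i, k⟩ h
    simp only [Finset.mem_sigma, Finset.mem_univ, true_and, Finset.mem_Icc] at h
    rw [Finset.mem_sdiff, mk_mem_shiftedShape, mk_mem_shiftedShape]
    dsimp only
    omega
  · rintro ⟨i, k⟩ _ ⟨j, m⟩ _ h
    simp only [Prod.mk.injEq, add_left_inj, Fin.val_inj] at h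
    obtain ⟨rfl, h⟩ := h
    simpa using h
  · rintro ⟨r, c⟩ h
    rw [Finset.mem_sdiff] at h
    obtain ⟨i, rfl, h1, h2⟩ := mem_shiftedShape.1 h.1
    have h3 := mt mk_mem_shiftedShape.2 h.2
    simp only at h1 h2
    refine ⟨⟨i, c - i⟩, ?_, ?_⟩
    · simp only [Finset.mem_sigma, Finset.mem_univ, true_and, Finset.mem_Icc]
      omega
    · simp only [Prod.mk.injEq, true_and]
      omega
  · rintro ⟨i, k⟩ h
    simp only [Finset.mem_sigma, Finset.mem_univ, true_and, Finset.mem_Icc] at h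
    dsimp only
    rw [hwt _ _ (by omega)]
    congr 1
    omega

lemma exists_initial_segment (m : ℕ) (P : ℕ → Prop) (h : ∀ j, j + 1 < m → P (j + 1) → P j) :
    ∃ k ≤ m, ∀ j < m, P j ↔ j < k := by
  induction m with
  | zero => exact ⟨0, le_rfl, by simp⟩
  | succ m ih =>
    obtain ⟨k, hk, hP⟩ := ih fun j hj => h j (by omega)
    by_cases hm : P m
    · refine ⟨m + 1, le_rfl, fun j hj => ⟨fun _ => hj, fun _ => ?_⟩⟩
      have : ∀ d ≤ m, P (m - d) := by
        intro d
        induction d with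
        | zero => exact fun _ => hm
        | succ d ihd =>
          intro hd
          refine h _ (by omega) ?_
          have := ihd (by omega)
          rwa [show m - (d + 1) + 1 = m - d by omega]
      have h2 := this (m - j) (by omega)
      rwa [show m - (m - j) = j by omega] at h2
    · refine ⟨k, by omega, fun j hj => ?_⟩
      rcases Nat.lt_succ_iff_lt_or_eq.1 hj with hj | rfl
      · exact hP j hj
      · exact ⟨fun h => absurd h hm, fun h => absurd h (by omega)⟩

/-- A part of a shifted diagram whose rows are initial segments is a shifted diagram. -/
lemma exists_shiftedShape_eq {lam : Fin l → ℕ} {D : Finset (ℕ × ℕ)} (hD : D ⊆ shiftedShape lam)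
    (h : ∀ b ∈ shiftedShape lam, b ∉ D → ∀ c ∈ shiftedShape lam, b.1 = c.1 → b.2 < c.2 → c ∉ D) :
    ∃ nu : Fin l → ℕ, (∀ i, nu i ≤ lam i) ∧ shiftedShape nu = D := by
  have : ∀ i : Fin l, ∃ k ≤ lam i, ∀ j < lam i, ((i : ℕ) + 1, j + i + 1) ∈ D ↔ j < k := by
    intro i
    refine exists_initial_segment _ _ fun j hj hjD => ?_
    by_contra hn
    exact h _ (mk_mem_shiftedShape.2 ⟨by omega, by omega⟩) hn _ (hD hjD) rfl
      (by simp only; omega) hjD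
  choose nu h1 h2 using this
  refine ⟨nu, h1, ?_⟩
  ext ⟨r, c⟩
  constructor
  · intro hb
    obtain ⟨i, rfl, h3, h4⟩ := mem_shiftedShape.1 hb
    have := (h2 i (c - i - 1) (by have := h1 i; simp only at h3 h4; omega)).2
      (by simp only at h3 h4; omega)
    rwa [show c - i - 1 + i + 1 = c by simp only at h3; omega] at this
  · intro hb
    obtain ⟨i, rfl, h3, h4⟩ := mem_shiftedShape.1 (hD hb)
    simp only at h3 h4
    have := (h2 i (c - i - 1) (by omega)).1
      (by rwa [show c - i - 1 + i + 1 = c by omega])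
    exact mk_mem_shiftedShape.2 ⟨by omega, by omega⟩

end ShiftedShape

/-! ### Strips in terms of row lengths. -/

section StripShape

variable {l : ℕ}

/-- `f i + i` is the column where row `i` ends; strictness makes these ends move weakly to the left,
so columns have no gaps. -/
lemma add_le_add_of_strictAnti {f : Fin l → ℕ} (hf : StrictAnti f) {i j : Fin l} (hij : i ≤ j) :
    f j + j ≤ f i + i := by
  obtain ⟨d, hd⟩ := Nat.exists_eq_add_of_le (Fin.le_def.1 hij)
  induction d generalizing j with
  | zero => rw [Fin.ext hd.symm]
  | succ d ih =>
    have hlt : (i : ℕ) + d < l := by omega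
    have h1 := ih (j := ⟨i + d, hlt⟩) (Fin.le_def.2 (by simp)) rfl
    have h2 : f j < f ⟨i + d, hlt⟩ := hf (Fin.lt_def.2 (by simp; omega))
    simp only at h1
    omega

/-- The least length of row `i` of a shifted diagram which differs from that with rows `lam i` by
at most one box in each column. -/
def lowerPart (lam : Fin l → ℕ) (i : Fin l) : ℕ :=
  if h : (i : ℕ) + 1 < l then lam ⟨i + 1, h⟩ + 1 else 0

/-- The last box of row `i + 1` lies under the box of row `i` at position `lam (i + 1) + 1`. That
box and those to its left must therefore stay, while the boxes to its right have nothing below. -/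
lemma isStrip_shiftedShape_iff_of_odd {N : ℕ} (hN : Odd N) {lam nu : Fin l → ℕ}
    (hlam : StrictAnti lam) (hpos : ∀ i, 0 < lam i) (hle : ∀ i, nu i ≤ lam i) :
    IsStrip N (shiftedShape nu) (shiftedShape lam) ↔ ∀ i, lowerPart lam i ≤ nu i := by
  constructor
  · intro h i
    rw [lowerPart]
    split_ifs with hi
    · by_contra hn
      have h1 := hlam (a := i) (b := ⟨i + 1, hi⟩) (Fin.lt_def.2 (by simp))
      have h2 := hpos ⟨i + 1, hi⟩
      have h3 := (h.2 ((i : ℕ) + 1, lam ⟨i + 1, hi⟩ + i + 1)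
        (mk_mem_shiftedShape.2 ⟨by omega, by omega⟩)
        (fun hb => by have := mk_mem_shiftedShape.1 hb; omega)
        ((i : ℕ) + 1 + 1, lam ⟨i + 1, hi⟩ + i + 1)
        ((mk_mem_shiftedShape (i := ⟨i + 1, hi⟩)).2 ⟨by dsimp only; omega, by dsimp only; omega⟩)).2
        rfl (by dsimp only; omega)
      exact (Nat.not_even_iff_odd.2 hN) h3.2
    · exact Nat.zero_le _
  · intro h
    refine ⟨shiftedShape_subset_iff.2 hle, ?_⟩
    rintro ⟨r, c⟩ hb hb' ⟨r', c'⟩ hc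
    obtain ⟨i, rfl, h1, h2⟩ := mem_shiftedShape.1 hb
    obtain ⟨j, rfl, h3, h4⟩ := mem_shiftedShape.1 hc
    have h5 := mt mk_mem_shiftedShape.2 hb'
    dsimp only at *
    constructor
    · intro hij hcc
      refine ⟨fun hc' => ?_, hN⟩
      have hij' : i = j := Fin.ext (by omega)
      subst hij'
      have := mk_mem_shiftedShape.1 hc'
      omega
    · intro hcc hij
      exfalso
      have hi : (i : ℕ) + 1 < l := by omega
      have h6 := h i
      rw [lowerPart, dif_pos hi] at h6
      have h7 := add_le_add_of_strictAnti hlam (i := ⟨i + 1, hi⟩) (j := j) (Fin.le_def.2 (by dsimp only; omega))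
      dsimp only at h7
      omega

/-- If strictness fails, row `i` loses its end box while the box below it stays, which no strip
permits. The bound `2 ≤ nu i` ensures that the box below exists: it excludes passing from the
lengths `(1, 0)` to `(0, 0)`, where the shape is a strip but the tuple is not strict. -/
lemma isStrip_shiftedShape_iff_of_even {N : ℕ} (hN : Even N) {nu mu : Fin l → ℕ}
    (hnu : StrictAnti nu) (hnu2 : ∀ i j, i < j → 2 ≤ nu i) (hle : ∀ i, mu i ≤ nu i) :
    IsStrip N (shiftedShape mu) (shiftedShape nu) ↔
      (∀ i, nu i - 1 ≤ mu i) ∧ StrictAnti mu := by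
  constructor
  · intro h
    have hge : ∀ i, nu i - 1 ≤ mu i := by
      intro i
      by_contra hn
      have h3 := (h.2 ((i : ℕ) + 1, nu i + i - 1) (mk_mem_shiftedShape.2 ⟨by omega, by omega⟩)
        (fun hb => by have := mk_mem_shiftedShape.1 hb; omega)
        ((i : ℕ) + 1, nu i + i) (mk_mem_shiftedShape.2 ⟨by omega, by omega⟩)).1
        rfl (by dsimp only; omega)
      exact (Nat.not_odd_iff_even.2 hN) h3.2
    refine ⟨hge, fun i j hij => ?_⟩
    by_contra hn
    have h1 := hge i
    have h2 := hle j
    have h3 := hnu hij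
    have h4 := add_le_add_of_strictAnti hnu hij.le
    have h5 := hnu2 i j hij
    have h6 := Fin.lt_def.1 hij
    have hj : (j : ℕ) = i + 1 := by omega
    refine ((h.2 ((i : ℕ) + 1, nu i + i) (mk_mem_shiftedShape.2 ⟨by omega, by omega⟩)
        (fun hb => by have := mk_mem_shiftedShape.1 hb; omega)
        ((j : ℕ) + 1, nu i + i) (mk_mem_shiftedShape.2 ⟨by omega, by omega⟩)).2
        rfl (by dsimp only; omega)).1 (mk_mem_shiftedShape.2 ⟨by omega, by omega⟩)
  · rintro ⟨hge, hmu⟩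
    refine ⟨shiftedShape_subset_iff.2 hle, ?_⟩
    rintro ⟨r, c⟩ hb hb' ⟨r', c'⟩ hc
    obtain ⟨i, rfl, h1, h2⟩ := mem_shiftedShape.1 hb
    obtain ⟨j, rfl, h3, h4⟩ := mem_shiftedShape.1 hc
    have h5 := mt mk_mem_shiftedShape.2 hb'
    have h6 := hge i
    dsimp only at *
    constructor
    · intro hij hcc
      have hij' : i = j := Fin.ext (by omega)
      subst hij'
      omega
    · intro hcc hij
      refine ⟨fun hc' => ?_, hN⟩
      have h7 := mk_mem_shiftedShape.1 hc'
      have h8 := add_le_add_of_strictAnti hmu (i := i) (j := j) (Fin.le_def.2 (by omega))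
      omega

open Classical in
lemma sum_isStrip_of_odd {R : Type*} [CommRing R] {N : ℕ} (hN : Odd N) {lam : Fin l → ℕ}
    (hlam : StrictAnti lam) (hpos : ∀ i, 0 < lam i) (F : Finset (ℕ × ℕ) → R) :
    ∑ D' ∈ (shiftedShape lam).powerset with IsStrip N D' (shiftedShape lam), F D' =
      ∑ nu ∈ Fintype.piFinset fun i => Finset.Icc (lowerPart lam i) (lam i),
        F (shiftedShape nu) := by
  symm
  refine Finset.sum_bij (fun nu _ => shiftedShape nu) ?_ ?_ ?_ fun _ _ => rfl
  · intro nu h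
    simp only [Fintype.mem_piFinset, Finset.mem_Icc] at h
    rw [Finset.mem_filter, Finset.mem_powerset]
    exact ⟨shiftedShape_subset_iff.2 fun i => (h i).2,
      (isStrip_shiftedShape_iff_of_odd hN hlam hpos fun i => (h i).2).2 fun i => (h i).1⟩
  · exact fun _ _ _ _ h => shiftedShape_injective h
  · intro D' h
    rw [Finset.mem_filter, Finset.mem_powerset] at h
    obtain ⟨nu, h1, rfl⟩ := exists_shiftedShape_eq h.1 fun b hb hb' c hc e1 e2 =>
      ((h.2.2 b hb hb' c hc).1 e1 e2).1
    refine ⟨nu, ?_, rfl⟩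
    simp only [Fintype.mem_piFinset, Finset.mem_Icc]
    exact fun i => ⟨(isStrip_shiftedShape_iff_of_odd hN hlam hpos h1).1 h.2 i, h1 i⟩

open Classical in
lemma sum_isStrip_of_even {R : Type*} [CommRing R] {N : ℕ} (hN : Even N) {nu : Fin l → ℕ}
    (hnu : StrictAnti nu) (hnu2 : ∀ i j, i < j → 2 ≤ nu i) (F : Finset (ℕ × ℕ) → R) :
    ∑ D' ∈ (shiftedShape nu).powerset with IsStrip N D' (shiftedShape nu), F D' =
      ∑ mu ∈ Fintype.piFinset (fun i => Finset.Icc (nu i - 1) (nu i)) with StrictAnti mu,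
        F (shiftedShape mu) := by
  symm
  refine Finset.sum_bij (fun mu _ => shiftedShape mu) ?_ ?_ ?_ fun _ _ => rfl
  · intro mu h
    simp only [Finset.mem_filter, Fintype.mem_piFinset, Finset.mem_Icc] at h
    rw [Finset.mem_filter, Finset.mem_powerset]
    exact ⟨shiftedShape_subset_iff.2 fun i => (h.1 i).2,
      (isStrip_shiftedShape_iff_of_even hN hnu hnu2 fun i => (h.1 i).2).2
        ⟨fun i => (h.1 i).1, h.2⟩⟩
  · exact fun _ _ _ _ h => shiftedShape_injective h
  · intro D' h
    rw [Finset.mem_filter, Finset.mem_powerset] at h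
    obtain ⟨mu, h1, rfl⟩ := exists_shiftedShape_eq h.1 fun b hb hb' c hc e1 e2 =>
      ((h.2.2 b hb hb' c hc).1 e1 e2).1
    refine ⟨mu, ?_, rfl⟩
    have h2 := (isStrip_shiftedShape_iff_of_even hN hnu hnu2 h1).1 h.2
    simp only [Finset.mem_filter, Fintype.mem_piFinset, Finset.mem_Icc]
    exact ⟨fun i => ⟨h2.1 i, h1 i⟩, h2.2⟩

end StripShape

/-! ### The branching rule and the induction on the number of variables. -/

section Branching

variable {K : Type*} [Field K]

/-- The polynomial function `(t - a_1) ... (t - a_m)`. -/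
def shiftedPow (a : ℕ → K) (m : ℕ) (t : K) : K := ∏ k ∈ Finset.Icc 1 m, (t - a k)

/-- Twice `shiftedPow` for `0 < m`, and the constant `1` for `m = 0`. -/
def doubledPow (a : ℕ → K) (m : ℕ) (t : K) : K := if m = 0 then 1 else 2 * shiftedPow a m t

/-- The result of adding at most one marked letter to the end of a row. -/
def markedStep (a : ℕ → K) (y : K) (k : ℕ) : K → K :=
  ∑ m ∈ Finset.Icc (k - 1) k, (∏ c ∈ Finset.Icc (m + 1) k, (y + a c)) • doubledPow a m

/-- The result of adding unmarked letters to the end of a row of length at least `p`. -/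
def unmarkedStep (a : ℕ → K) (y : K) (p m : ℕ) : K → K :=
  ∑ k ∈ Finset.Icc p m, (∏ c ∈ Finset.Icc (k + 1) m, (y - a c)) • markedStep a y k

/-- The weight of the box `b` filled with the letter of code `N`. -/
def letterWeight (a : ℕ → K) (x : ℕ → K) (N : ℕ) (b : ℕ × ℕ) : K :=
  if Even N then x (N / 2) + a (b.2 - b.1 + 1) else x (N / 2) - a (b.2 - b.1 + 1)

lemma shiftedPow_succ (a : ℕ → K) (m : ℕ) (t : K) :
    shiftedPow a (m + 1) t = shiftedPow a m t * (t - a (m + 1)) :=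
  Finset.prod_Icc_succ_top (by omega) _

lemma shiftedPow_eq_zero {a : ℕ → K} (ha : a 1 = 0) {m : ℕ} (hm : 0 < m) :
    shiftedPow a m 0 = 0 :=
  Finset.prod_eq_zero (Finset.mem_Icc.2 ⟨le_rfl, hm⟩) (by rw [ha, sub_zero])

lemma doubledPow_zero (a : ℕ → K) : doubledPow a 0 = 1 := by
  ext t; simp [doubledPow]

lemma doubledPow_of_pos (a : ℕ → K) {m : ℕ} (hm : 0 < m) (t : K) :
    doubledPow a m t = 2 * shiftedPow a m t := if_neg hm.ne'

lemma markedStep_zero (a : ℕ → K) (y t : K) : markedStep a y 0 t = 1 := by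
  simp [markedStep, doubledPow_zero]

lemma markedStep_succ (a : ℕ → K) (y t : K) (k : ℕ) :
    markedStep a y (k + 1) t = doubledPow a (k + 1) t + (y + a (k + 1)) * doubledPow a k t := by
  rw [markedStep, Nat.add_sub_cancel, ← Finset.insert_Icc_add_one_left_eq_Icc k.le_succ,
    Finset.sum_insert (by simp)]
  simp [add_comm]

lemma markedStep_one {a : ℕ → K} (ha : a 1 = 0) (y t : K) : markedStep a y 1 t = 2 * t + y := by
  rw [markedStep_succ, doubledPow_of_pos a (Nat.succ_pos 0), doubledPow_zero]
  simp [shiftedPow, ha]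

/-- The end box is either kept, with factor `t - a (k + 2)`, or marked, with factor `y + a (k + 2)`;
the sum `t + y` is the numerator of the ratio. -/
lemma markedStep_add_two (a : ℕ → K) (y t : K) (k : ℕ) :
    markedStep a y (k + 2) t = 2 * (t + y) * shiftedPow a (k + 1) t := by
  rw [markedStep_succ, doubledPow_of_pos a (by omega), doubledPow_of_pos a (by omega),
    shiftedPow_succ]
  ring

/-- Telescoping of `(t | a)^k - (y - a_k) (t | a)^(k-1) = (t - y) (t | a)^(k-1)`. -/
lemma shiftedPow_sub_eq (a : ℕ → K) (y t : K) {p m : ℕ} (h : p ≤ m) :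
    shiftedPow a m t - (∏ c ∈ Finset.Icc (p + 1) m, (y - a c)) * shiftedPow a p t =
      (t - y) * ∑ k ∈ Finset.Icc (p + 1) m,
        (∏ c ∈ Finset.Icc (k + 1) m, (y - a c)) * shiftedPow a (k - 1) t := by
  induction m, h using Nat.le_induction with
  | base => simp
  | succ m h ih =>
    have h1 : ∀ k ∈ Finset.Icc (p + 1) m,
        (∏ c ∈ Finset.Icc (k + 1) (m + 1), (y - a c)) * shiftedPow a (k - 1) t =
        (y - a (m + 1)) * ((∏ c ∈ Finset.Icc (k + 1) m, (y - a c)) * shiftedPow a (k - 1) t) := by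
      intro k hk
      rw [Finset.prod_Icc_succ_top (by have := Finset.mem_Icc.1 hk; omega)]
      ring
    rw [shiftedPow_succ, Finset.prod_Icc_succ_top (by omega), Finset.sum_Icc_succ_top (by omega),
      Finset.sum_congr rfl h1, ← Finset.mul_sum]
    simp only [Nat.add_sub_cancel, Finset.Icc_eq_empty_of_lt (Nat.lt_succ_self (m + 1)),
      Finset.prod_empty, one_mul]
    linear_combination (y - a (m + 1)) * ih

lemma prod_Icc_mul_shiftedPow (a : ℕ → K) (y : K) {p m : ℕ} (h : p ≤ m) :
    (∏ c ∈ Finset.Icc (p + 1) m, (y - a c)) * shiftedPow a p y = shiftedPow a m y := by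
  induction m, h using Nat.le_induction with
  | base => simp
  | succ m h ih =>
    rw [Finset.prod_Icc_succ_top (by omega), shiftedPow_succ, ← ih]
    ring

/-- With `p` the length of the next row, the correction is a multiple of that row's own function, so
a row operation removes it. The constants at `y` cancel by `prod_Icc_mul_shiftedPow`. -/
lemma unmarkedStep_of_pos (a : ℕ → K) {y t : K} (hty : t ≠ y) {p m : ℕ} (hp : 0 < p)
    (h : p ≤ m) :
    unmarkedStep a y (p + 1) m t = (t + y) / (t - y) * (doubledPow a m t - doubledPow a m y) -
      (∏ c ∈ Finset.Icc (p + 1) m, (y - a c)) *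
        ((t + y) / (t - y) * (doubledPow a p t - doubledPow a p y)) := by
  have h0 : t - y ≠ 0 := sub_ne_zero.2 hty
  have h1 : unmarkedStep a y (p + 1) m t = 2 * (t + y) * ∑ k ∈ Finset.Icc (p + 1) m,
        (∏ c ∈ Finset.Icc (k + 1) m, (y - a c)) * shiftedPow a (k - 1) t := by
    rw [unmarkedStep, Finset.sum_apply, Finset.mul_sum]
    refine Finset.sum_congr rfl fun k hk => ?_
    obtain ⟨k, rfl⟩ := Nat.exists_eq_add_of_le' (show 2 ≤ k by have := Finset.mem_Icc.1 hk; omega)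
    rw [Pi.smul_apply, markedStep_add_two, smul_eq_mul, show k + 2 - 1 = k + 1 from rfl]
    ring
  have h2 := shiftedPow_sub_eq a y t h
  rw [h1, doubledPow_of_pos a (hp.trans_le h), doubledPow_of_pos a (hp.trans_le h),
    doubledPow_of_pos a hp, doubledPow_of_pos a hp, ← prod_Icc_mul_shiftedPow a y h]
  field_simp
  linear_combination -2 * (t + y) * h2

/-- The case of the last row. The terms `k = 0` and `k = 1` have exceptional factors `y - a_1 = y`
and `2 * t + y`; they add up to the regular `2 * (t + y)` precisely because `a_1 = 0`. -/
lemma unmarkedStep_zero {a : ℕ → K} (ha : a 1 = 0) {y t : K} (hty : t ≠ y) {m : ℕ} (hm : 0 < m) :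
    unmarkedStep a y 0 m t = (t + y) / (t - y) * (doubledPow a m t - doubledPow a m y) := by
  have h0 : t - y ≠ 0 := sub_ne_zero.2 hty
  obtain ⟨m, rfl⟩ := Nat.exists_eq_add_of_le' hm
  have h2 := shiftedPow_sub_eq a y t (Nat.zero_le (m + 1))
  have h3 := prod_Icc_mul_shiftedPow a y (Nat.zero_le (m + 1))
  have hz : ∀ s, shiftedPow a 0 s = 1 := fun s => by simp [shiftedPow]
  rw [hz, mul_one] at h2 h3
  rw [zero_add] at h2 h3
  rw [h3] at h2
  have h1 : unmarkedStep a y 0 (m + 1) t = 2 * (t + y) * ∑ k ∈ Finset.Icc 1 (m + 1),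
        (∏ c ∈ Finset.Icc (k + 1) (m + 1), (y - a c)) * shiftedPow a (k - 1) t := by
    rw [unmarkedStep, Finset.sum_apply,
      ← Finset.insert_Icc_add_one_left_eq_Icc (Nat.zero_le (m + 1)), Finset.sum_insert (by simp),
      zero_add, ← Finset.insert_Icc_add_one_left_eq_Icc (by omega : 1 ≤ m + 1),
      Finset.sum_insert (by simp), Finset.sum_insert (by simp), mul_add, Finset.mul_sum,
      ← add_assoc]
    congr 1
    · simp only [Pi.smul_apply, smul_eq_mul]
      rw [markedStep_zero, markedStep_one ha, Nat.sub_self, hz,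
        Finset.prod_insert (by simp), ha]
      ring
    · refine Finset.sum_congr rfl fun k hk => ?_
      obtain ⟨k, rfl⟩ :=
        Nat.exists_eq_add_of_le' (show 2 ≤ k by have := Finset.mem_Icc.1 hk; omega)
      rw [Pi.smul_apply, markedStep_add_two, smul_eq_mul, show k + 2 - 1 = k + 1 from rfl]
      ring
  rw [h1, doubledPow_of_pos a m.succ_pos, doubledPow_of_pos a m.succ_pos]
  field_simp
  linear_combination -2 * (t + y) * h2

variable [DecidableEq K]

/-- Multilinear expansion. The intervals `[lam (i + 1) + 1, lam i]` are disjoint, so every tuple is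
strict, and only its last entry can be less than `2`. -/
lemma symmForm_unmarkedStep {a : ℕ → K} {X : Finset K} {N : ℕ} (hN : Odd N) {x : ℕ → K} {l : ℕ}
    (H : ∀ nu : Fin l → ℕ, StrictAnti nu → (∀ i j, i < j → 2 ≤ nu i) →
      symmForm l X (fun i => markedStep a (x (N / 2)) (nu i)) =
      stripSum (letterWeight a x) N (shiftedShape nu))
    {lam : Fin l → ℕ} (hlam : StrictAnti lam) (hpos : ∀ i, 0 < lam i) :
    symmForm l X (fun i => unmarkedStep a (x (N / 2)) (lowerPart lam i) (lam i)) =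
      stripSum (letterWeight a x) (N + 1) (shiftedShape lam) := by
  classical
  rw [stripSum, sum_isStrip_of_odd hN hlam hpos]
  simp only [unmarkedStep]
  rw [MultilinearMap.map_sum_finset]
  refine Finset.sum_congr rfl fun nu hnu => ?_
  simp only [Fintype.mem_piFinset, Finset.mem_Icc] at hnu
  have hlow : ∀ i j, i < j → lam j + 1 ≤ nu i := by
    intro i j hij
    have hij' := Fin.lt_def.1 hij
    have h1 := (hnu i).1
    have h2 : (i : ℕ) + 1 < l := by omega
    rw [lowerPart, dif_pos h2] at h1
    have := hlam.antitone (a := ⟨i + 1, h2⟩) (b := j) (Fin.le_def.2 (by dsimp only; omega))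
    omega
  rw [MultilinearMap.map_smul_univ, H nu, smul_eq_mul,
    prod_shiftedShape_sdiff _ fun c => x (N / 2) - a c]
  · intro r c _
    simp [letterWeight, Nat.not_even_iff_odd.2 hN]
  · intro i j hij
    have := hlow i j hij
    have := (hnu j).2
    omega
  · intro i j hij
    have := hlow i j hij
    have := hpos j
    omega

variable [CharZero K]

/-- Extends the induction hypothesis to shapes whose last row has become empty, where the parity
condition is indispensable. -/
lemma symmForm_eq_stripSum_of_parity {a : ℕ → K} (ha : a 1 = 0) {X : Finset K}
    (h0 : (0 : K) ∉ X) {N : ℕ} {wt : ℕ → ℕ × ℕ → K}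
    (H : ∀ (l : ℕ) (mu : Fin l → ℕ), StrictAnti mu → (∀ i, 0 < mu i) →
      symmForm l X (fun i => doubledPow a (mu i)) = stripSum wt N (shiftedShape mu))
    {X' : Finset K} (hX' : X' = X ∨ X' = insert 0 X) {l : ℕ} (hl : Even (X'.card + l))
    {mu : Fin l → ℕ} (hmu : StrictAnti mu) :
    symmForm l X' (fun i => doubledPow a (mu i)) = stripSum wt N (shiftedShape mu) := by
  have H' : ∀ (l : ℕ) (mu : Fin l → ℕ), StrictAnti mu → (∀ i, 0 < mu i) →
      symmForm l X' (fun i => doubledPow a (mu i)) = stripSum wt N (shiftedShape mu) := by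
    intro l mu hmu hpos
    rw [← H l mu hmu hpos]
    rcases hX' with rfl | rfl
    · rfl
    · exact symmForm_insert_zero l h0 _ fun i => by
        rw [doubledPow_of_pos a (hpos i), shiftedPow_eq_zero ha (hpos i), mul_zero]
  by_cases hpos : ∀ i, 0 < mu i
  · exact H' l mu hmu hpos
  · push Not at hpos
    obtain ⟨i, hi⟩ := hpos
    obtain ⟨l, rfl⟩ : ∃ k, l = k + 1 := ⟨l - 1, by have := i.2; omega⟩
    have hlast : mu (Fin.last l) = 0 := by
      have := hmu.antitone (Fin.le_last i)
      omega
    rw [symmForm_snoc_one l (by rwa [add_assoc]) _ (by rw [hlast, doubledPow_zero]),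
      ← shiftedShape_init hlast]
    refine H' l (Fin.init mu) (fun i j hij => hmu (Fin.castSucc_lt_castSucc_iff.2 hij)) fun i => ?_
    have := hmu (Fin.castSucc_lt_last i)
    rw [Fin.init]
    omega

/-- Lowering a strict sequence by at most one in each entry can destroy strictness only by making
two neighbours equal. -/
lemma symmForm_doubledPow_eq_zero (a : ℕ → K) (X : Finset K) {l : ℕ} {mu nu : Fin l → ℕ}
    (hnu : StrictAnti nu) (h1 : ∀ i, mu i ≤ nu i) (h2 : ∀ i, nu i - 1 ≤ mu i)
    (hmu : ¬ StrictAnti mu) : symmForm l X (fun i => doubledPow a (mu i)) = 0 := by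
  rcases l with _ | l
  · exact absurd (fun i => i.elim0) hmu
  · rw [Fin.strictAnti_iff_succ_lt] at hmu
    push Not at hmu
    obtain ⟨i, hi⟩ := hmu
    refine symmForm_eq_zero_of_adjacent X _ i ?_
    have h3 := h1 i.succ
    have h4 := h2 i.castSucc
    have h5 := hnu (Fin.castSucc_lt_succ (i := i))
    rw [show mu i.castSucc = mu i.succ by omega]

lemma symmForm_markedStep {a : ℕ → K} {X : Finset K} {N : ℕ} (hN : Even N) {x : ℕ → K} {l : ℕ}
    (H : ∀ mu : Fin l → ℕ, StrictAnti mu → symmForm l X (fun i => doubledPow a (mu i)) =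
      stripSum (letterWeight a x) N (shiftedShape mu))
    {nu : Fin l → ℕ} (hnu : StrictAnti nu) (hnu2 : ∀ i j, i < j → 2 ≤ nu i) :
    symmForm l X (fun i => markedStep a (x (N / 2)) (nu i)) =
      stripSum (letterWeight a x) (N + 1) (shiftedShape nu) := by
  classical
  rw [stripSum, sum_isStrip_of_even hN hnu hnu2]
  simp only [markedStep]
  rw [MultilinearMap.map_sum_finset, Finset.sum_filter]
  refine Finset.sum_congr rfl fun mu hmu => ?_
  simp only [Fintype.mem_piFinset, Finset.mem_Icc] at hmu
  rw [MultilinearMap.map_smul_univ]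
  split_ifs with hs
  · rw [H mu hs, smul_eq_mul, prod_shiftedShape_sdiff _ fun c => x (N / 2) + a c]
    intro r c _
    simp [letterWeight, hN]
  · rw [symmForm_doubledPow_eq_zero a X hnu (fun i => (hmu i).2) (fun i => (hmu i).1) hs,
      smul_zero]

lemma symmForm_sub_const_eq_unmarkedStep {a : ℕ → K} (ha : a 1 = 0) {X : Finset K} {y : K}
    (hy : y ∉ X) {l : ℕ} {lam : Fin l → ℕ} (hlam : StrictAnti lam) (hpos : ∀ i, 0 < lam i) :
    symmForm l X (fun i t =>
        (t + y) / (t - y) * (doubledPow a (lam i) t - doubledPow a (lam i) y)) =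
      symmForm l X (fun i => unmarkedStep a y (lowerPart lam i) (lam i)) := by
  -- Past the last row the length is `0`, where `doubledPow` is constant; so `G l = 0`, as the row
  -- operations require.
  set p : ℕ → ℕ := fun i => if h : i < l then lam ⟨i, h⟩ else 0
  have hp : ∀ i : Fin l, p i = lam i := fun i => dif_pos i.2
  set G : ℕ → K → K := fun i t => (t + y) / (t - y) * (doubledPow a (p i) t - doubledPow a (p i) y)
  have hG : G l = 0 := by
    ext t
    simp [G, p, doubledPow_zero]
  have h := symmForm_sub_smul_next l X G
    (fun i => ∏ c ∈ Finset.Icc (p (i + 1) + 1) (p i), (y - a c)) hG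
  simp only [G, hp] at h
  rw [← h]
  refine symmForm_congr fun i t ht => ?_
  have hty : t ≠ y := fun e => hy (e ▸ ht)
  by_cases hi : (i : ℕ) + 1 < l
  · have hp1 : p (i + 1) = lam ⟨i + 1, hi⟩ := dif_pos hi
    rw [lowerPart, dif_pos hi, unmarkedStep_of_pos a hty (hpos _)
      (hlam.antitone (Fin.le_def.2 (by simp)))]
    simp [hp1]
  · have hp1 : p (i + 1) = 0 := dif_neg hi
    rw [lowerPart, dif_neg hi, unmarkedStep_zero ha hty (hpos i)]
    simp [hp1, doubledPow_zero]

/-- The symmetrization of doubled generalized powers as a sum over chains of strips. -/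
theorem symmForm_eq_stripSum {a : ℕ → K} (ha : a 1 = 0) {x : ℕ → K} (n : ℕ)
    (hx : Set.InjOn x (Set.Iio n)) (hx0 : ∀ k < n, x k ≠ 0) (l : ℕ) (lam : Fin l → ℕ)
    (hlam : StrictAnti lam) (hpos : ∀ i, 0 < lam i) :
    symmForm l ((Finset.range n).image x) (fun i => doubledPow a (lam i)) =
      stripSum (letterWeight a x) (2 * n) (shiftedShape lam) := by
  induction n generalizing l lam with
  | zero =>
    rcases l with _ | l
    · simp [symmForm_zero, stripSum, shiftedShape]
    · have hne : shiftedShape lam ≠ ∅ := by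
        refine Finset.nonempty_iff_ne_empty.1
          ⟨(((0 : Fin (l + 1)) : ℕ) + 1, 1), mk_mem_shiftedShape.2 ⟨by simp, ?_⟩⟩
        have := hpos 0
        omega
      rw [symmForm_eq_zero_of_card_lt (by simp), Nat.mul_zero, stripSum, if_neg hne]
  | succ n ih =>
    set X := (Finset.range n).image x
    have hX0 : (0 : K) ∉ X := by
      simp only [X, Finset.mem_image, Finset.mem_range, not_exists, not_and]
      exact fun k hk => hx0 k (by omega)
    have hy : x n ∉ X := by
      simp only [X, Finset.mem_image, Finset.mem_range, not_exists, not_and]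
      intro k hk h
      have := hx (Set.mem_Iio.2 (by omega)) (Set.mem_Iio.2 (by omega)) h
      omega
    have IH := ih (hx.mono (Set.Iio_subset_Iio n.le_succ)) fun k hk => hx0 k (by omega)
    have hyn0 : x n ≠ 0 := hx0 n n.lt_succ_self
    -- The variable `0` corrects the parity; the variables must be nonzero for it to be new.
    obtain ⟨X', hX', hpar⟩ : ∃ X', (X' = X ∨ X' = insert 0 X) ∧ Even (X'.card + l) := by
      by_cases h : Even (X.card + l)
      · exact ⟨X, Or.inl rfl, h⟩
      · refine ⟨insert 0 X, Or.inr rfl, ?_⟩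
        rw [Finset.card_insert_of_notMem hX0, add_right_comm]
        exact Nat.even_add_one.2 h
    have hy' : x n ∉ X' := by
      rcases hX' with rfl | rfl
      · exact hy
      · simp [hy, hyn0]
    have h1 : symmForm l ((Finset.range (n + 1)).image x) (fun i => doubledPow a (lam i)) =
        symmForm l (insert (x n) X') (fun i => doubledPow a (lam i)) := by
      rw [Finset.range_add_one, Finset.image_insert]
      rcases hX' with rfl | rfl
      · rfl
      · rw [Finset.insert_comm, symmForm_insert_zero]
        · simp [hX0, hyn0.symm]
        · intro i
          rw [doubledPow_of_pos a (hpos i), shiftedPow_eq_zero ha (hpos i), mul_zero]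
    have e1 : 2 * n / 2 = n := by omega
    have e2 : (2 * n + 1) / 2 = n := by omega
    rw [h1, symmForm_insert l hy' hpar, symmForm_sub_const_eq_unmarkedStep ha hy' hlam hpos]
    have hV := fun nu : Fin l → ℕ => symmForm_markedStep (a := a) (X := X') (x := x)
      (even_two_mul n) (fun mu hmu => symmForm_eq_stripSum_of_parity ha hX0 IH hX' hpar hmu)
      (nu := nu)
    rw [e1] at hV
    have hU := symmForm_unmarkedStep (a := a) (X := X') (x := x) (N := 2 * n + 1)
      (odd_two_mul_add_one n) (by rw [e2]; exact hV) hlam hpos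
    rw [e2] at hU
    exact hU

end Branching

/-! ### The sum over permutations as `symmForm`. -/

section Symmetrization

lemma image_swap_succ {α : Type*} [DecidableEq α] {n : ℕ} {x : Fin (n + 1) → α}
    (hx : Function.Injective x) (p : Fin (n + 1)) :
    Finset.univ.image (fun j : Fin n => x (Equiv.swap 0 p j.succ)) =
      (Finset.univ.image x).erase (x p) := by
  ext t
  simp only [Finset.mem_image, Finset.mem_univ, true_and, Finset.mem_erase]
  constructor
  · rintro ⟨j, rfl⟩
    refine ⟨fun h => ?_, _, rfl⟩
    have h1 := hx h
    rw [Equiv.swap_apply_eq_iff, Equiv.swap_apply_right] at h1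
    exact Fin.succ_ne_zero j h1
  · rintro ⟨ht, q, rfl⟩
    have hq : Equiv.swap 0 p q ≠ 0 := fun h => by
      rw [Equiv.swap_apply_eq_iff, Equiv.swap_apply_left] at h
      exact ht (congrArg x h)
    obtain ⟨j, hj⟩ := Fin.exists_succ_eq.2 hq
    exact ⟨j, by rw [hj, Equiv.swap_apply_self]⟩

variable {K : Type*} [Field K] [DecidableEq K]

/-- A summand depends only on the first `l` values of `ω`, which have `(n - l)!` extensions. The
induction splits off the value `p` at `0`; the other values are permuted freely, so the first ratio
product does not depend on them. -/
theorem sum_perm_eq_symmForm (l n : ℕ) (h : l ≤ n) {x : Fin n → K} (hx : Function.Injective x)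
    (g : Fin l → K → K) :
    ∑ ω : Equiv.Perm (Fin n), (∏ i : Fin l, g i (x (ω (Fin.castLE h i)))) *
        ∏ i : Fin l, ∏ j ∈ Finset.Ioi (Fin.castLE h i),
          (x (ω (Fin.castLE h i)) + x (ω j)) / (x (ω (Fin.castLE h i)) - x (ω j)) =
      ((n - l).factorial : K) * symmForm l (Finset.univ.image x) g := by
  induction l generalizing n with
  | zero => simp [symmForm_zero, Fintype.card_perm]
  | succ l ih =>
    obtain ⟨n, rfl⟩ := Nat.exists_eq_add_of_le' (show 1 ≤ n by omega)
    have h' : l ≤ n := by omega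
    rw [← Equiv.sum_comp Equiv.Perm.decomposeFin.symm, Fintype.sum_prod_type, symmForm_succ,
      Finset.sum_image hx.injOn, Finset.mul_sum]
    refine Finset.sum_congr rfl fun p _ => ?_
    have hx' : Function.Injective fun j : Fin n => x (Equiv.swap 0 p j.succ) :=
      hx.comp ((Equiv.swap 0 p).injective.comp (Fin.succ_injective n))
    have hI := ih n h' hx' (Fin.tail g)
    rw [image_swap_succ hx] at hI
    rw [Nat.add_sub_add_right]
    have hr : ∀ e : Equiv.Perm (Fin n),
        ∏ j, (x p + x (Equiv.swap 0 p (e j).succ)) / (x p - x (Equiv.swap 0 p (e j).succ)) =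
        ratioProd (Finset.univ.image x) (x p) := by
      intro e
      rw [ratioProd, ← image_swap_succ hx, Finset.prod_image hx'.injOn]
      exact Equiv.prod_comp e fun j =>
        (x p + x (Equiv.swap 0 p j.succ)) / (x p - x (Equiv.swap 0 p j.succ))
    calc _ = ∑ e : Equiv.Perm (Fin n), g 0 (x p) * ratioProd (Finset.univ.image x) (x p) *
          ((∏ i : Fin l, Fin.tail g i (x (Equiv.swap 0 p (e (Fin.castLE h' i)).succ))) *
          ∏ i : Fin l, ∏ j ∈ Finset.Ioi (Fin.castLE h' i),
          (x (Equiv.swap 0 p (e (Fin.castLE h' i)).succ) + x (Equiv.swap 0 p (e j).succ)) /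
          (x (Equiv.swap 0 p (e (Fin.castLE h' i)).succ) - x (Equiv.swap 0 p (e j).succ))) := by
          refine Finset.sum_congr rfl fun e _ => ?_
          rw [Fin.prod_univ_succ, Fin.prod_univ_succ, ← hr e]
          simp only [Fin.castLE_succ, Fin.castLE_zero, Fin.prod_Ioi_zero, Fin.prod_Ioi_succ,
            Equiv.Perm.decomposeFin_symm_apply_zero, Equiv.Perm.decomposeFin_symm_apply_succ,
            Fin.tail]
          ring
      _ = _ := by
          rw [← Finset.mul_sum, hI]
          ring

lemma ratVar_injective (n : ℕ) : Function.Injective (ratVar : Fin n → RatFun n) :=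
  (IsFractionRing.injective (MvPolynomial (Fin n) ℂ) (RatFun n)).comp (MvPolynomial.X_injective)

lemma ratVar_ne_zero {n : ℕ} (i : Fin n) : (ratVar i : RatFun n) ≠ 0 := by
  rw [ratVar, Ne, IsFractionRing.to_map_eq_zero_iff]
  exact MvPolynomial.X_ne_zero i

open Classical in
lemma symmSum_eq_symmForm (l n : ℕ) (g : Fin l → RatFun n → RatFun n) :
    symmSum l n g = symmForm l (Finset.univ.image ratVar) g := by
  rw [symmSum]
  split_ifs with h
  · rw [sum_perm_eq_symmForm l n h (ratVar_injective n), ← mul_assoc, one_div,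
      inv_mul_cancel₀ (Nat.cast_ne_zero.2 (Nat.factorial_ne_zero _)), one_mul]
  · rw [symmForm_eq_zero_of_card_lt]
    rw [Finset.card_image_of_injective _ (ratVar_injective n)]
    simpa using h

end Symmetrization

/-! ### Marked tableaux encoded by natural numbers, and the formula. -/

section Tableaux

namespace Letter

/-- The position of a letter in the alphabet. -/
def code {n : ℕ} (t : Letter n) : ℕ := 2 * (ofLex t).1 + (if (ofLex t).2 then 1 else 0)

lemma code_lt {n : ℕ} (t : Letter n) : t.code < 2 * n := by
  have := (ofLex t).1.2
  rw [code]
  split_ifs <;> omega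

lemma code_le_code {n : ℕ} {s t : Letter n} : s.code ≤ t.code ↔ s ≤ t := by
  rw [Prod.Lex.le_iff, code, code, Fin.lt_def, Fin.ext_iff]
  rcases (ofLex s).2 with _ | _ <;> rcases (ofLex t).2 with _ | _ <;> simp <;> omega

lemma code_injective {n : ℕ} : Function.Injective (code : Letter n → ℕ) := fun _ _ h =>
  le_antisymm (code_le_code.1 h.le) (code_le_code.1 h.ge)

lemma exists_code_eq {n N : ℕ} (h : N < 2 * n) : ∃ t : Letter n, t.code = N := by
  refine ⟨toLex (⟨N / 2, by omega⟩, decide (N % 2 = 1)), ?_⟩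
  simp only [code, ofLex_toLex, decide_eq_true_eq]
  split_ifs <;> omega

lemma even_code_iff {n : ℕ} {t : Letter n} : Even t.code ↔ t = marked t.abs := by
  rw [code, marked, abs, ← ofLex_inj, ofLex_toLex, Prod.ext_iff]
  rcases (ofLex t).2 with _ | _ <;> simp

lemma odd_code_iff {n : ℕ} {t : Letter n} : Odd t.code ↔ t = unmarked t.abs := by
  rw [code, unmarked, abs, ← ofLex_inj, ofLex_toLex, Prod.ext_iff]
  rcases (ofLex t).2 with _ | _ <;> simp

lemma code_div_two {n : ℕ} (t : Letter n) : t.code / 2 = t.abs := by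
  rw [code, abs]
  split_ifs <;> omega

lemma sgn_eq {n : ℕ} (t : Letter n) : t.sgn = if Even t.code then -1 else 1 := by
  rw [sgn, code]
  rcases (ofLex t).2 with _ | _ <;> simp

end Letter

/-- Passes from neighbouring boxes to arbitrary pairs in a row or column, which is possible because
rows and columns of the diagram have no gaps. -/
lemma isMarkedTableau_iff (lam : StrictPartition) (n : ℕ) (T : lam.shiftedDiagram → Letter n) :
    IsMarkedTableau lam n T ↔
      IsParityTableau lam.shiftedDiagram (fun b => (T b).code) := by
  constructor
  · intro hT
    have hrow : ∀ (d r c : ℕ) (h : (r, c) ∈ lam.shiftedDiagram)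
        (h' : (r, c + d) ∈ lam.shiftedDiagram), T ⟨(r, c), h⟩ ≤ T ⟨(r, c + d), h'⟩ := by
      intro d
      induction d with
      | zero => exact fun _ _ _ _ => le_rfl
      | succ d ih =>
        intro r c h h'
        have h1 : (r, c + d) ∈ lam.shiftedDiagram := by
          obtain ⟨i, rfl, h2, h3⟩ := mem_shiftedShape.1 h
          have h4 := mk_mem_shiftedShape.1 h'
          exact mk_mem_shiftedShape.2 ⟨by dsimp only at *; omega, by omega⟩
        exact (ih r c h h1).trans (hT.row_le r (c + d) h1 h')
    have hcol : ∀ (d r c : ℕ) (h : (r, c) ∈ lam.shiftedDiagram)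
        (h' : (r + d, c) ∈ lam.shiftedDiagram), T ⟨(r, c), h⟩ ≤ T ⟨(r + d, c), h'⟩ := by
      intro d
      induction d with
      | zero => exact fun _ _ _ _ => le_rfl
      | succ d ih =>
        intro r c h h'
        have h1 : (r + d, c) ∈ lam.shiftedDiagram := by
          obtain ⟨i, rfl, h2, h3⟩ := mem_shiftedShape.1 h
          obtain ⟨j, h4, h5, h6⟩ := mem_shiftedShape.1 h'
          dsimp only at *
          have hlt : (i : ℕ) + d < lam.length := by omega
          have h7 := add_le_add_of_strictAnti lam.strictAnti (i := ⟨i + d, hlt⟩) (j := j)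
            (Fin.le_def.2 (by dsimp only; omega))
          dsimp only at h7
          exact mem_shiftedShape.2 ⟨⟨i + d, hlt⟩, by dsimp only; omega, by dsimp only; omega,
            by dsimp only; omega⟩
        exact (ih r c h h1).trans (hT.col_le (r + d) c h1 h')
    rintro ⟨⟨r, c⟩, h⟩ ⟨⟨r', c'⟩, h'⟩
    dsimp only
    constructor
    · rintro rfl hc
      obtain ⟨d, rfl⟩ := Nat.exists_eq_add_of_le hc.le
      refine ⟨Letter.code_le_code.2 (hrow d r c h h'), fun he => ?_⟩
      by_contra ho
      have h1 := Letter.even_code_iff.1 (Nat.not_odd_iff_even.1 ho)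
      have h2 := Letter.code_injective he
      have := hT.row_marked _ ⟨(r, c), h⟩ ⟨(r, c + d), h'⟩ rfl h1 (h2 ▸ h1)
      simp only [Subtype.mk.injEq, Prod.mk.injEq, true_and] at this
      omega
    · rintro rfl hr
      obtain ⟨d, rfl⟩ := Nat.exists_eq_add_of_le hr.le
      refine ⟨Letter.code_le_code.2 (hcol d r c h h'), fun he => ?_⟩
      by_contra ho
      have h1 := Letter.odd_code_iff.1 (Nat.not_even_iff_odd.1 ho)
      have h2 := Letter.code_injective he
      have := hT.col_unmarked _ ⟨(r, c), h⟩ ⟨(r + d, c), h'⟩ rfl h1 (h2 ▸ h1)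
      simp only [Subtype.mk.injEq, Prod.mk.injEq, and_true] at this
      omega
  · intro hT
    refine ⟨fun i j h h' => ?_, fun i j h h' => ?_, fun k b c hbc hb hc => ?_,
      fun k b c hbc hb hc => ?_⟩
    · exact Letter.code_le_code.1 ((hT ⟨_, h⟩ ⟨_, h'⟩).2 rfl (Nat.lt_succ_self i)).1
    · exact Letter.code_le_code.1 ((hT ⟨_, h⟩ ⟨_, h'⟩).1 rfl (Nat.lt_succ_self j)).1
    · have hodd : ∀ b, T b = Letter.unmarked k → ¬ Even (T b).code := fun b hb => by
        rw [Nat.not_even_iff_odd, Letter.odd_code_iff, hb]; rfl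
      have he : (T b).code = (T c).code := by rw [hb, hc]
      rcases lt_trichotomy b.1.1 c.1.1 with h | h | h
      · exact absurd (((hT b c).2 hbc h).2 he) (hodd b hb)
      · exact Subtype.ext (Prod.ext h hbc)
      · exact absurd (((hT c b).2 hbc.symm h).2 he.symm) (hodd c hc)
    · have heven : ∀ b, T b = Letter.marked k → ¬ Odd (T b).code := fun b hb => by
        rw [Nat.not_odd_iff_even, Letter.even_code_iff, hb]; rfl
      have he : (T b).code = (T c).code := by rw [hb, hc]
      rcases lt_trichotomy b.1.2 c.1.2 with h | h | h
      · exact absurd (((hT b c).1 hbc h).2 he) (heven b hb)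
      · exact Subtype.ext (Prod.ext hbc h)
      · exact absurd (((hT c b).1 hbc.symm h).2 he.symm) (heven c hc)

theorem sum_markedTableaux {R : Type*} [CommRing R] (lam : StrictPartition) (n : ℕ)
    (wt : ℕ → ℕ × ℕ → R) :
    ∑ T ∈ markedTableaux lam n, ∏ b : lam.shiftedDiagram, wt (T b).code b =
      stripSum wt (2 * n) lam.shiftedDiagram := by
  classical
  rw [← sum_parityTableau]
  refine Finset.sum_bij (fun T _ b => (T b).code) ?_ ?_ ?_ fun _ _ => rfl
  · intro T hT
    rw [markedTableaux, Finset.mem_filter] at hT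
    simp only [Finset.mem_filter, Fintype.mem_piFinset, Finset.mem_range]
    exact ⟨fun b => (T b).code_lt, (isMarkedTableau_iff lam n T).1 hT.2⟩
  · intro T _ T' _ h
    ext b
    exact Letter.code_injective (congrFun h b)
  · intro T hT
    simp only [Finset.mem_filter, Fintype.mem_piFinset, Finset.mem_range] at hT
    choose T' hT' using fun b => Letter.exists_code_eq (hT.1 b)
    have : (fun b => (T' b).code) = T := funext hT'
    refine ⟨T', ?_, this⟩
    rw [markedTableaux, Finset.mem_filter]
    exact ⟨Finset.mem_univ _, (isMarkedTableau_iff lam n T').2 (this ▸ hT.2)⟩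

theorem multiQ_eq_sum_markedTableaux (lam : StrictPartition) (n : ℕ) {a : ℕ → ℂ} (ha : a 1 = 0) :
    multiQ lam a n = algebraMap (MvPolynomial (Fin n) ℂ) (RatFun n)
      (∑ T ∈ markedTableaux lam n, ∏ b : lam.shiftedDiagram,
        (MvPolynomial.X (T b).abs -
          MvPolynomial.C ((T b).sgn * a (b.1.2 - b.1.1 + 1)))) := by
  classical
  set a' : ℕ → RatFun n := fun k => algebraMap ℂ (RatFun n) (a k)
  set x : ℕ → RatFun n := fun k => if h : k < n then ratVar ⟨k, h⟩ else 0
  have hxk : ∀ k : Fin n, x k = ratVar k := fun k => dif_pos k.2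
  have hx : Set.InjOn x (Set.Iio n) := fun i hi j hj h => by
    have h1 : x (⟨i, hi⟩ : Fin n) = x (⟨j, hj⟩ : Fin n) := h
    rw [hxk, hxk] at h1
    exact congrArg Fin.val (ratVar_injective n h1)
  have himage : (Finset.range n).image x = Finset.univ.image ratVar := by
    ext t
    simp only [Finset.mem_image, Finset.mem_range, Finset.mem_univ, true_and]
    exact ⟨fun ⟨k, hk, h⟩ => ⟨⟨k, hk⟩, by rw [← hxk, h]⟩, fun ⟨k, h⟩ => ⟨k, k.2, by rw [hxk, h]⟩⟩
  have h1 := symmForm_eq_stripSum (a := a') (by simp [a', ha]) n hx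
    (fun k hk => by rw [hxk ⟨k, hk⟩]; exact ratVar_ne_zero _) lam.length lam.part
    lam.strictAnti lam.pos
  -- All parts are positive, so each of the `l` arguments releases a factor `2`, giving `2 ^ l`.
  have h2 : (fun i => doubledPow a' (lam.part i)) =
      fun i => (2 : RatFun n) • genPow a (lam.part i) := by
    ext i t
    rw [doubledPow_of_pos a' (lam.pos i)]
    rfl
  rw [himage, h2, MultilinearMap.map_smul_univ (symmForm lam.length _) (fun _ => 2),
    Finset.prod_const, Finset.card_univ, Fintype.card_fin, smul_eq_mul,
    ← symmSum_eq_symmForm] at h1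
  rw [multiQ, multiP, h1]
  rw [show shiftedShape lam.part = lam.shiftedDiagram from rfl, ← sum_markedTableaux, map_sum]
  refine Finset.sum_congr rfl fun T _ => ?_
  rw [map_prod]
  refine Finset.prod_congr rfl fun b _ => ?_
  have hC : ∀ z : ℂ, algebraMap (MvPolynomial (Fin n) ℂ) (RatFun n) (MvPolynomial.C z) =
      algebraMap ℂ (RatFun n) z := fun z =>
    (IsScalarTower.algebraMap_apply ℂ (MvPolynomial (Fin n) ℂ) (RatFun n) z).symm
  rw [letterWeight, Letter.code_div_two, hxk, Letter.sgn_eq, map_sub, hC, ratVar]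
  split_ifs <;> simp [a']

end Tableaux

end MultiparamSchur

theorem mainTheorem2 (lam : StrictPartition) (n : ℕ) :
    (∀ a : ℕ → ℂ, a 1 = 0 →
      multiQ lam a n =
        algebraMap (MvPolynomial (Fin n) ℂ) (FractionRing (MvPolynomial (Fin n) ℂ))
          (∑ T ∈ markedTableaux lam n, ∏ b : lam.shiftedDiagram,
            (MvPolynomial.X (T b).abs -
              MvPolynomial.C ((T b).sgn * a (b.1.2 - b.1.1 + 1))))) ∧
    factorialQ lam n =
      algebraMap (MvPolynomial (Fin n) ℂ) (FractionRing (MvPolynomial (Fin n) ℂ))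
        (∑ T ∈ markedTableaux lam n, ∏ b : lam.shiftedDiagram,
          (MvPolynomial.X (T b).abs -
            MvPolynomial.C ((T b).sgn * (((b.1.2 : ℕ) : ℂ) - ((b.1.1 : ℕ) : ℂ))))) := by
  refine ⟨fun a ha => multiQ_eq_sum_markedTableaux lam n ha, ?_⟩
  have h := multiQ_eq_sum_markedTableaux lam n (a := fun k => (k : ℂ) - 1) (by simp)
  have h1 : factorialQ lam n = multiQ lam (fun k => (k : ℂ) - 1) n := by
    rw [factorialQ, multiQ, factorialP, multiP]
    congr 2
    ext i t
    rw [fallingPow, genPow]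
    refine Finset.prod_congr rfl fun k _ => ?_
    rw [map_sub, map_natCast, map_one]
    ring
  rw [h1, h]
  congr 1
  refine Finset.sum_congr rfl fun T _ => Finset.prod_congr rfl fun b _ => ?_
  -- The index `j - i + 1` of `a` uses truncated subtraction, which is exact on boxes on or right of
  -- the diagonal.
  have hb : b.1.1 ≤ b.1.2 := by
    obtain ⟨i, h1, h2, _⟩ := mem_shiftedShape.1 b.2
    omega
  rw [Nat.cast_add, Nat.cast_sub hb, Nat.cast_one, add_sub_cancel_right]
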